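/- \textbf{Conventions.} For a finite Borel measure $\mu$ on $\mathbb{R}$ put $\widehat{\mu}(\xi)=\int_{\mathbb{R}} e^{-2\pi i x\xi}\,d\mu(x)$. The support $\mathrm{supp}(\mu)$ is the intersection of all closed sets $F$ with $\mu(\mathbb{R}\setminus F)=0$. For $A\subseteq\mathbb{R}$ let $\mathcal{M}(A)$ be the set of all non-zero finite Borel measures on $\mathbb{R}$ with compact support contained in $A$, let $\dim_H(A)$ be the Hausdorff dimension of $A$, and let $$\dim_F(A)=\sup\Bigl\{0\le s\le 1:\ \sup_{\xi\in\mathbb{R}}|\widehat{\mu}(\xi)|^2|\xi|^s<\infty\ \text{ for some }\mu\in\mathcal{M}(A)\Bigr\}.$$ For a non-zero finite Borel measure $\mu$ on $\mathbb{R}$ let $$\dim_F(\mu)=\sup\Bigl\{0\le s\le 1:\ \sup_{\xi\in\mathbb{R}}|\widehat{\mu}(\xi)|^2|\xi|^s<\infty\Bigr\},$$ $$\dim_H(\mu)=\sup\Bigl\{s\ge 0:\ \liminf_{r\to 0^+}\frac{\ln\mu(B(x,r))}{\ln r}\ge s\ \text{ for $\mu$-a.e. }x\in\mathbb{R}\Bigr\}.$$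 For $R,Y\subseteq\mathbb{R}$ let $RY=\{ry: r\in R,\ y\in Y\}$, and for finite Borel measures $\mu,\nu$ on $\mathbb{R}$ let $\mu\cdot\nu$ be the Borel measure on $\mathbb{R}$ with $\int f\,d(\mu\cdot\nu)=\int\int f(ry)\,d\mu(r)\,d\nu(y)$, i.e. the image of $\mu\times\nu$ under $(r,y)\mapsto ry$. \textbf{Theorem.} Let $\alpha\in[0,1]$. (1) For every compact set $Y\subseteq\mathbb{R}$ which contains a non-zero point, there exists a non-empty compact set $R\subseteq(0,\infty)$ such that $\dim_H(R)=\dim_F(R)=\alpha$ and $$\dim_F(RY)\ \ge\ \min\{1,\ \dim_F(R)+\dim_F(Y)\}.$$ (2) For every non-zero finite Borel measure $\nu$ on $\mathbb{R}$ whose support is compact and does not contain $0$, there exists a Borel probability measure $\mu$ on $\mathbb{R}$ such that $\mathrm{supp}(\mu)\subseteq[1,2]$, $\dim_H(\mu)=\dim_F(\mu)=\alpha$, and $$\dim_F(\mu\cdot\nu)\ \ge\ \min\{1,\ \dim_F(\mu)+\dim_F(\nu)\}.$$ -/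

import Mathlib

open MeasureTheory Set Filter Topology
open scoped NNReal ENNReal Pointwise

namespace FourierDimension

/-- The Fourier transform `ξ ↦ ∫ exp (-2πi x ξ) dμ(x)` of a finite Borel measure on `ℝ`. -/
noncomputable def measureHat (μ : Measure ℝ) (ξ : ℝ) : ℂ :=
  ∫ x : ℝ, Complex.exp (-2 * Real.pi * Complex.I * x * ξ) ∂μ

/-- `sup_ξ |μ̂(ξ)|² |ξ|^s < ∞`. -/
def HasFourierDecay (μ : Measure ℝ) (s : ℝ) : Prop :=
  BddAbove (range fun ξ : ℝ => ‖measureHat μ ξ‖ ^ 2 * |ξ| ^ s)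

/-- The non-zero finite Borel measures on `ℝ` with compact support contained in `A`. -/
def measuresOn (A : Set ℝ) : Set (Measure ℝ) :=
  {μ | IsFiniteMeasure μ ∧ μ ≠ 0 ∧ IsCompact μ.support ∧ μ.support ⊆ A}

/-- The Fourier dimension of a set `A ⊆ ℝ`: the supremum of those `s ∈ [0, 1]` for which some
`μ ∈ measuresOn A` has `sup_ξ |μ̂(ξ)|² |ξ|^s < ∞`. -/
noncomputable def dimF (A : Set ℝ) : ℝ≥0∞ :=
  ⨆ (s : ℝ≥0) (_ : s ≤ 1 ∧ ∃ μ ∈ measuresOn A, HasFourierDecay μ s), (s : ℝ≥0∞)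

/-- The Fourier dimension of a (non-zero finite Borel) measure on `ℝ`: the supremum of those
`s ∈ [0, 1]` for which `sup_ξ |μ̂(ξ)|² |ξ|^s < ∞`. -/
noncomputable def measureDimF (μ : Measure ℝ) : ℝ≥0∞ :=
  ⨆ (s : ℝ≥0) (_ : s ≤ 1 ∧ HasFourierDecay μ s), (s : ℝ≥0∞)

/-- The lower local dimension `liminf_{r → 0⁺} log μ(B(x, r)) / log r` of a finite measure at `x`,
as an extended real. The value off the support of `μ`, where the logarithm of `0` is not meaningful,
is irrelevant below, since the complement of the support is a `μ`-null set. -/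
noncomputable def lowerLocalDim (μ : Measure ℝ) (x : ℝ) : EReal :=
  liminf (fun r : ℝ => ((Real.log (μ.real (Metric.ball x r)) / Real.log r : ℝ) : EReal)) (𝓝[>] 0)

/-- The Hausdorff dimension of a (non-zero finite Borel) measure on `ℝ`: the supremum of those
`s ≥ 0` for which the lower local dimension is at least `s` at `μ`-almost every point. -/
noncomputable def measureDimH (μ : Measure ℝ) : ℝ≥0∞ :=
  ⨆ (s : ℝ≥0) (_ : ∀ᵐ x ∂μ, ((s : ℝ) : EReal) ≤ lowerLocalDim μ x), (s : ℝ≥0∞)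

/-- The multiplicative convolution `μ · ν`, i.e. the measure with
`∫ f d(μ · ν) = ∫ ∫ f (r * y) dμ(r) dν(y)`: the image of the product measure under multiplication. -/
noncomputable def mulMeasure (μ ν : Measure ℝ) : Measure ℝ :=
  Measure.mconv μ ν

end FourierDimension

/-!
The measure `μ` and the set `R` are the natural measure and the limit set of one jittered Cantor set.
Generation `n` consists of `nodes T n` points. Each of them has `T n` children, which are spread over
an interval of length `scale n = 2 ^ (-(n+1)²)`: this interval is divided into `T n` equal cells, and
one child is placed in each cell, at a position to be chosen. With `T n` about
`(scale n / scale (n+1)) ^ α`, the limit set has dimension `α` whatever the positions are. It is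
covered by `nodes T n ≈ (scale n) ^ (-α)` intervals of length `2 * scale n`, and at most `5 ^ n` of
these meet a given interval of length `scale n` (`card_position_mem_Icc_le`). Since the lengths
decrease superexponentially, the factor `5 ^ n` is negligible.

The coverings bound all dimensions from above. For the Hausdorff dimensions this is immediate; for the
Fourier dimensions, a measure `σ` with decay of order `s` has Gaussian energy `O (r ^ s)` at scale `r`
(`exists_integral_prod_gaussian_le`), while the Cauchy-Schwarz inequality for a covering by `N`
intervals of length `r` bounds this energy from below by a multiple of `1 / N`.

The positions are chosen to make Fourier transforms small. The Fourier transform at `ξ` of `μ · ν` is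
the integral of `measureHat ν (x ξ)` over `dμ(x)`, hence a limit of averages over the nodes of a
generation. If every child were uniformly distributed in its cell, independently of the others, the
averages of the conditional expectations `smoothedHat ν ξ k n` over generation `n` would form a
martingale, because the cells of a node together make up an interval. The increment from
generation `n` to `n + 1` is a sum of `nodes T (n+1)` independent terms of mean zero and size
`|ξ| ^ (-s/2) / nodes T (n+1)`, where `s` is the order of decay of `ν`. By Hoeffding's inequality and
a union bound over polynomially many frequencies, it is at most about
`|ξ| ^ (-s/2) * (nodes T (n+1)) ^ (-1/2)`. No probability space is needed: the positions are chosen one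
after the other so that an exponential potential stays under control
(`exists_norm_sum_sub_integral_le`). For the generations with `1 / scale n` somewhat smaller than
`|ξ|`, the conditional expectations themselves are tiny, since the sum of the remaining displacements
has a smooth distribution (`norm_smoothedHat_le_pow`); this uses that the support of `ν` avoids `0`.
So only generations with `nodes T (n+1)` at least about `|ξ| ^ α` contribute, and the decay is
`|ξ| ^ (-(α+s)/2)`, up to a small power (`hasFourierDecay_mulMeasure`). The Dirac mass at `1` in the
role of `ν` gives the decay of `μ` itself.

All this can be done for countably many `ν` at once, which suffices for the set `Y`: one measure for
each rational order of decay is enough (`exists_measure_of_class`). A measure on `Y` with decay of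
positive order is multiplied by a smooth bump supported away from `0` before it is used
(`exists_zero_notMem_support`).
-/

namespace FourierDimension

/-! ### Fourier transforms of finite measures -/

/-- The character `t ↦ exp (-2πit)`, so that `measureHat μ ξ = ∫ fexp (x * ξ) dμ(x)`. -/
noncomputable def fexp (t : ℝ) : ℂ := Complex.exp ((-2 * Real.pi * t : ℝ) * Complex.I)

lemma norm_fexp (t : ℝ) : ‖fexp t‖ = 1 := Complex.norm_exp_ofReal_mul_I _

lemma fexp_zero : fexp 0 = 1 := by simp [fexp]

lemma fexp_add (a b : ℝ) : fexp (a + b) = fexp a * fexp b := by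
  rw [fexp, fexp, fexp, ← Complex.exp_add]
  congr 1
  push_cast
  ring

lemma fexp_neg (a : ℝ) : fexp (-a) = (starRingEnd ℂ) (fexp a) := by
  rw [fexp, fexp, ← Complex.exp_conj, map_mul, Complex.conj_ofReal, Complex.conj_I]
  congr 1
  push_cast
  ring

@[fun_prop]
lemma continuous_fexp : Continuous fexp := by
  unfold fexp
  fun_prop

lemma norm_fexp_sub_le (a b : ℝ) : ‖fexp a - fexp b‖ ≤ 2 * Real.pi * |a - b| := by
  have h : fexp a - fexp b = fexp b * (fexp (a - b) - 1) := by
    rw [mul_sub, ← fexp_add]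
    simp
  rw [h, norm_mul, norm_fexp, one_mul, fexp, mul_comm _ Complex.I]
  refine (Real.norm_exp_I_mul_ofReal_sub_one_le).trans_eq ?_
  rw [Real.norm_eq_abs, abs_mul, abs_mul, abs_neg, abs_of_pos Real.pi_pos]
  simp

lemma measureHat_eq_integral_fexp (μ : Measure ℝ) (ξ : ℝ) :
    measureHat μ ξ = ∫ x, fexp (x * ξ) ∂μ := by
  unfold measureHat fexp
  congr 1
  ext x
  congr 1
  push_cast
  ring

lemma integrable_fexp_comp {Ω : Type*} [MeasurableSpace Ω] (μ : Measure Ω) [IsFiniteMeasure μ]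
    {g : Ω → ℝ} (hg : Measurable g) : Integrable (fun x => fexp (g x)) μ :=
  Integrable.of_bound ((continuous_fexp.measurable.comp hg).aestronglyMeasurable) 1
    (Eventually.of_forall fun _ => (norm_fexp _).le)

lemma norm_measureHat_le (μ : Measure ℝ) [IsFiniteMeasure μ] (ξ : ℝ) :
    ‖measureHat μ ξ‖ ≤ μ.real univ := by
  rw [measureHat_eq_integral_fexp]
  have := norm_integral_le_of_norm_le_const (μ := μ) (f := fun x => fexp (x * ξ)) (C := 1)
    (Eventually.of_forall fun x => (norm_fexp _).le)
  simpa using this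

lemma measureHat_neg (μ : Measure ℝ) (ξ : ℝ) :
    measureHat μ (-ξ) = (starRingEnd ℂ) (measureHat μ ξ) := by
  rw [measureHat_eq_integral_fexp, measureHat_eq_integral_fexp, ← integral_conj]
  simp_rw [mul_neg, fexp_neg]

lemma continuous_measureHat (μ : Measure ℝ) [IsFiniteMeasure μ] : Continuous (measureHat μ) := by
  simp_rw [funext (measureHat_eq_integral_fexp μ)]
  refine continuous_of_dominated (bound := fun _ => 1)
    (fun ξ => (integrable_fexp_comp μ (by fun_prop)).aestronglyMeasurable)
    (fun ξ => Eventually.of_forall fun x => (norm_fexp _).le) (integrable_const _)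
    (Eventually.of_forall fun _ => by fun_prop)

lemma norm_measureHat_sub_le (μ : Measure ℝ) [IsFiniteMeasure μ] {A : ℝ}
    (hA : ∀ᵐ x ∂μ, |x| ≤ A) (ξ η : ℝ) :
    ‖measureHat μ ξ - measureHat μ η‖ ≤ 2 * Real.pi * A * |ξ - η| * μ.real univ := by
  rw [measureHat_eq_integral_fexp, measureHat_eq_integral_fexp,
    ← integral_sub (integrable_fexp_comp μ (by fun_prop)) (integrable_fexp_comp μ (by fun_prop))]
  refine norm_integral_le_of_norm_le_const ?_
  filter_upwards [hA] with x hx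
  refine (norm_fexp_sub_le _ _).trans ?_
  rw [← mul_sub, abs_mul, ← mul_assoc]
  gcongr

/-- Fourier decay with the weight `(1 + |ξ|)`, which avoids the singularity at the origin. -/
lemma hasFourierDecay_iff_exists (μ : Measure ℝ) [IsFiniteMeasure μ] {s : ℝ} (hs : 0 ≤ s) :
    HasFourierDecay μ s ↔ ∃ C, 0 ≤ C ∧ ∀ ξ, ‖measureHat μ ξ‖ ≤ C * (1 + |ξ|) ^ (-(s / 2)) := by
  constructor
  · rintro ⟨B, hB⟩
    have hB' : ∀ ξ : ℝ, ‖measureHat μ ξ‖ ^ 2 * |ξ| ^ s ≤ B := fun ξ => hB ⟨ξ, rfl⟩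
    have hC0 : 0 ≤ (2 : ℝ) ^ (s / 2) * max (Real.sqrt B) (μ.real univ) := by positivity
    refine ⟨2 ^ (s / 2) * max (Real.sqrt B) (μ.real univ), hC0, fun ξ => ?_⟩
    rw [Real.rpow_neg (by positivity), ← div_eq_mul_inv, le_div_iff₀ (by positivity)]
    rcases le_total |ξ| 1 with h | h
    · have h1 : (1 + |ξ|) ^ (s / 2) ≤ 2 ^ (s / 2) :=
        Real.rpow_le_rpow (by positivity) (by linarith) (by linarith)
      calc _ ≤ μ.real univ * 2 ^ (s / 2) := by
            gcongr
            exact norm_measureHat_le μ ξ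
        _ ≤ _ := by
          rw [mul_comm]
          gcongr
          exact le_max_right _ _
    · have h1 : (1 + |ξ|) ^ (s / 2) ≤ 2 ^ (s / 2) * |ξ| ^ (s / 2) := by
        rw [← Real.mul_rpow (by norm_num) (abs_nonneg _)]
        exact Real.rpow_le_rpow (by positivity) (by linarith) (by linarith)
      have h2 : ‖measureHat μ ξ‖ * |ξ| ^ (s / 2) ≤ Real.sqrt B := by
        refine Real.le_sqrt_of_sq_le ?_
        rw [mul_pow, ← Real.rpow_mul_natCast (abs_nonneg _)]
        convert hB' ξ using 3
        push_cast
        ring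
      calc _ ≤ ‖measureHat μ ξ‖ * (2 ^ (s / 2) * |ξ| ^ (s / 2)) := by gcongr
        _ = 2 ^ (s / 2) * (‖measureHat μ ξ‖ * |ξ| ^ (s / 2)) := by ring
        _ ≤ _ := by
          gcongr
          exact h2.trans (le_max_left _ _)
  · rintro ⟨C, hC0, hC⟩
    refine ⟨C ^ 2, ?_⟩
    rintro _ ⟨ξ, rfl⟩
    have h1 : |ξ| ^ s ≤ (1 + |ξ|) ^ s :=
      Real.rpow_le_rpow (abs_nonneg _) (by linarith) hs
    calc ‖measureHat μ ξ‖ ^ 2 * |ξ| ^ s ≤ (C * (1 + |ξ|) ^ (-(s / 2))) ^ 2 * (1 + |ξ|) ^ s := by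
          gcongr
          exact hC ξ
      _ = C ^ 2 * ((1 + |ξ|) ^ (-s) * (1 + |ξ|) ^ s) := by
          rw [mul_pow, ← Real.rpow_mul_natCast (by positivity), mul_assoc]
          congr 3
          push_cast
          ring
      _ = C ^ 2 := by rw [← Real.rpow_add (by positivity)]; simp

lemma HasFourierDecay.mono {μ : Measure ℝ} [IsFiniteMeasure μ] {s t : ℝ}
    (h : HasFourierDecay μ s) (ht : 0 ≤ t) (hts : t ≤ s) : HasFourierDecay μ t := by
  rw [hasFourierDecay_iff_exists μ (ht.trans hts)] at h
  obtain ⟨C, hC0, hC⟩ := h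
  refine (hasFourierDecay_iff_exists μ ht).2 ⟨C, hC0, fun ξ => (hC ξ).trans ?_⟩
  gcongr
  linarith [abs_nonneg ξ]

lemma hasFourierDecay_zero (μ : Measure ℝ) [IsFiniteMeasure μ] : HasFourierDecay μ 0 :=
  (hasFourierDecay_iff_exists μ le_rfl).2
    ⟨μ.real univ, measureReal_nonneg, fun ξ => by simpa using norm_measureHat_le μ ξ⟩

instance (μ ν : Measure ℝ) [IsFiniteMeasure μ] [IsFiniteMeasure ν] :
    IsFiniteMeasure (mulMeasure μ ν) := by
  unfold mulMeasure Measure.mconv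
  infer_instance

lemma measureHat_mulMeasure (μ ν : Measure ℝ) [IsFiniteMeasure μ] [IsFiniteMeasure ν] (ξ : ℝ) :
    measureHat (mulMeasure μ ν) ξ = ∫ x, measureHat ν (x * ξ) ∂μ := by
  rw [measureHat_eq_integral_fexp, mulMeasure, Measure.mconv,
    integral_map (by fun_prop) (by fun_prop),
    integral_prod _ (integrable_fexp_comp _ (by fun_prop))]
  congr 1
  ext x
  rw [measureHat_eq_integral_fexp]
  congr 1
  ext y
  congr 1
  ring

/-- Decay along the sequence `√k` implies decay: the gaps `√(k+1) - √k` are at most `1/√k`, and the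
Fourier transform of a compactly supported measure is Lipschitz. -/
lemma hasFourierDecay_of_sqrt (μ : Measure ℝ) [IsFiniteMeasure μ] {A : ℝ}
    (hA : ∀ᵐ x ∂μ, |x| ≤ A) {s : ℝ} (hs : 0 ≤ s) (hs2 : s ≤ 2)
    {C : ℝ} (h : ∀ k : ℕ, ‖measureHat μ (Real.sqrt k)‖ ≤ C * (1 + Real.sqrt k) ^ (-(s / 2))) :
    HasFourierDecay μ s := by
  have hC0 : 0 ≤ C := by
    have := (norm_nonneg _).trans (h 0)
    simpa using this
  set M := μ.real univ
  have hM : 0 ≤ M := measureReal_nonneg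
  set A' := max A 0
  have hA' : ∀ᵐ x ∂μ, |x| ≤ A' := hA.mono fun x hx => hx.trans (le_max_left _ _)
  have hA0 : 0 ≤ A' := le_max_right _ _
  have key : ∀ ξ : ℝ, 0 ≤ ξ → ‖measureHat μ ξ‖ ≤
      (C * 2 ^ (s / 2) + 2 * Real.pi * A' * M * 2) * (1 + ξ) ^ (-(s / 2)) := by
    intro ξ hξ
    set k := ⌊ξ ^ 2⌋₊
    have hk1 : (k : ℝ) ≤ ξ ^ 2 := Nat.floor_le (by positivity)
    have hk2 : ξ ^ 2 < k + 1 := Nat.lt_floor_add_one _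
    set η := Real.sqrt k
    have hη0 : 0 ≤ η := Real.sqrt_nonneg _
    have hη2 : η ^ 2 = k := Real.sq_sqrt (Nat.cast_nonneg _)
    have hηξ : η ≤ ξ := by nlinarith
    have hgap : (ξ - η) * (1 + ξ) ≤ 2 := by nlinarith
    have hξη : 1 + ξ ≤ 2 * (1 + η) := by nlinarith
    have h1 : (1 + η) ^ (-(s / 2)) ≤ 2 ^ (s / 2) * (1 + ξ) ^ (-(s / 2)) := by
      rw [Real.rpow_neg (by positivity), Real.rpow_neg (by positivity), ← div_eq_mul_inv,
        inv_eq_one_div, div_le_div_iff₀ (by positivity) (by positivity), one_mul,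
        ← Real.mul_rpow (by norm_num) (by positivity)]
      exact Real.rpow_le_rpow (by positivity) hξη (by linarith)
    have h2 : |ξ - η| ≤ 2 * (1 + ξ) ^ (-(s / 2)) := by
      rw [abs_of_nonneg (by linarith)]
      calc ξ - η ≤ 2 * (1 + ξ) ^ (-1 : ℝ) := by
            rw [Real.rpow_neg_one, ← div_eq_mul_inv, le_div_iff₀ (by positivity)]
            exact hgap
        _ ≤ _ := by
          gcongr
          · linarith
          · linarith
    calc ‖measureHat μ ξ‖ = ‖measureHat μ η + (measureHat μ ξ - measureHat μ η)‖ := by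
          rw [add_sub_cancel]
      _ ≤ C * (1 + η) ^ (-(s / 2)) + 2 * Real.pi * A' * |ξ - η| * M :=
          (norm_add_le _ _).trans (add_le_add (h k) (norm_measureHat_sub_le μ hA' ξ η))
      _ ≤ C * (2 ^ (s / 2) * (1 + ξ) ^ (-(s / 2))) +
          2 * Real.pi * A' * (2 * (1 + ξ) ^ (-(s / 2))) * M := by gcongr
      _ = _ := by ring
  refine (hasFourierDecay_iff_exists μ hs).2
    ⟨C * 2 ^ (s / 2) + 2 * Real.pi * A' * M * 2, by positivity, fun ξ => ?_⟩
  rcases le_total 0 ξ with h0 | h0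
  · rw [abs_of_nonneg h0]
    exact key ξ h0
  · rw [abs_of_nonpos h0, ← neg_neg ξ, measureHat_neg, RCLike.norm_conj, neg_neg]
    exact key (-ξ) (by linarith)

/-! ### A derandomised Hoeffding inequality -/

lemma exp_le_self_add_exp_sq (x : ℝ) : Real.exp x ≤ x + Real.exp (x ^ 2) := by
  rcases le_total x 0 with hx | hx
  · have h1 : Real.exp x * Real.exp (-x) = 1 := by rw [← Real.exp_add]; simp
    have h2 := Real.add_one_le_exp (x ^ 2)
    rcases le_total x (-1) with h | h
    · have : Real.exp x ≤ 1 := Real.exp_le_one_iff.2 hx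
      nlinarith
    · have := Real.abs_exp_sub_one_sub_id_le (x := x) (abs_le.2 ⟨h, by linarith⟩)
      have := (abs_le.1 this).2
      linarith
  · rcases le_total x 1 with h | h
    · have := Real.abs_exp_sub_one_sub_id_le (x := x) (abs_le.2 ⟨by linarith, h⟩)
      have := (abs_le.1 this).2
      have h2 := Real.add_one_le_exp (x ^ 2)
      linarith
    · have : Real.exp x ≤ Real.exp (x ^ 2) := Real.exp_le_exp.2 (by nlinarith)
      linarith

/-- A mean-zero function bounded by `2` has moment generating function at most `exp (4 λ²)`. -/
lemma integral_exp_le {g : ℝ → ℝ} (hg : ContinuousOn g (Icc 0 1)) (hb : ∀ t ∈ Icc (0 : ℝ) 1, |g t| ≤ 2)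
    (h0 : ∫ t in (0 : ℝ)..1, g t = 0) (l : ℝ) :
    ∫ t in (0 : ℝ)..1, Real.exp (l * g t) ≤ Real.exp (4 * l ^ 2) := by
  have hg' : ContinuousOn g (uIcc 0 1) := by rwa [uIcc_of_le zero_le_one]
  calc ∫ t in (0 : ℝ)..1, Real.exp (l * g t)
      ≤ ∫ t in (0 : ℝ)..1, (l * g t + Real.exp (4 * l ^ 2)) := by
        refine intervalIntegral.integral_mono_on zero_le_one ?_ ?_ fun t ht => ?_
        · exact ContinuousOn.intervalIntegrable (by fun_prop)
        · exact ContinuousOn.intervalIntegrable (by fun_prop)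
        · refine (exp_le_self_add_exp_sq _).trans ?_
          gcongr
          rw [mul_pow, mul_comm]
          have h4 : g t ^ 2 ≤ 4 := by nlinarith [abs_le.1 (hb t ht)]
          gcongr
    _ = Real.exp (4 * l ^ 2) := by
        rw [intervalIntegral.integral_add (ContinuousOn.intervalIntegrable (by fun_prop))
          (by simp), intervalIntegral.integral_const_mul, h0]
        simp

lemma exists_le_integral_Icc {f : ℝ → ℝ} (hf : ContinuousOn f (Icc 0 1)) :
    ∃ t ∈ Icc (0 : ℝ) 1, f t ≤ ∫ u in (0 : ℝ)..1, f u := by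
  obtain ⟨t, ht, hmin⟩ := isCompact_Icc.exists_isMinOn ⟨0, by simp⟩ hf
  refine ⟨t, ht, ?_⟩
  have : ∫ u in (0 : ℝ)..1, f t ≤ ∫ u in (0 : ℝ)..1, f u := by
    refine intervalIntegral.integral_mono_on zero_le_one (by simp) ?_ fun u hu => hmin hu
    exact ContinuousOn.intervalIntegrable (by rwa [uIcc_of_le zero_le_one])
  simpa using this

/-- The points `t m` are chosen one at a time so that the potential `∑ a, exp (l * ∑ m, g a m (t m))`
grows by a factor of at most `exp (4 l²)` in each step. -/
lemma exists_potential_le {ι : Type*} (A : Finset ι) (g : ι → ℕ → ℝ → ℝ)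
    (hg : ∀ a m, ContinuousOn (g a m) (Icc 0 1)) (hb : ∀ a m, ∀ t ∈ Icc (0 : ℝ) 1, |g a m t| ≤ 2)
    (h0 : ∀ a m, ∫ t in (0 : ℝ)..1, g a m t = 0) (l : ℝ) (N : ℕ) :
    ∃ t : ℕ → ℝ, (∀ m, t m ∈ Icc (0 : ℝ) 1) ∧
      ∑ a ∈ A, Real.exp (l * ∑ m ∈ Finset.range N, g a m (t m)) ≤
        A.card * Real.exp (4 * l ^ 2) ^ N := by
  induction N with
  | zero => exact ⟨fun _ => 0, fun _ => by simp, by simp⟩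
  | succ N ih =>
    obtain ⟨t, ht, hsum⟩ := ih
    set S : ι → ℝ := fun a => ∑ m ∈ Finset.range N, g a m (t m)
    have hcont : ∀ a, ContinuousOn (fun u => Real.exp (l * S a) * Real.exp (l * g a N u))
        (Icc 0 1) := fun a => by
      have := hg a N
      fun_prop
    obtain ⟨u, hu, hle⟩ := exists_le_integral_Icc
      (f := fun u => ∑ a ∈ A, Real.exp (l * S a) * Real.exp (l * g a N u))
      (continuousOn_finsetSum _ fun a _ => hcont a)
    refine ⟨fun m => if m < N then t m else u, fun m => ?_, ?_⟩
    · dsimp only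
      split_ifs
      exacts [ht m, hu]
    · have hS : ∀ a, ∑ m ∈ Finset.range (N + 1), g a m (if m < N then t m else u) =
          S a + g a N u := fun a => by
        rw [Finset.sum_range_succ]
        simp only [lt_irrefl, if_false]
        congr 1
        refine Finset.sum_congr rfl fun m hm => ?_
        rw [if_pos (Finset.mem_range.1 hm)]
      simp_rw [hS, mul_add, Real.exp_add]
      refine hle.trans ?_
      rw [intervalIntegral.integral_finsetSum fun a _ => ContinuousOn.intervalIntegrable
        (by rw [uIcc_of_le zero_le_one]; exact hcont a)]
      calc _ ≤ ∑ a ∈ A, Real.exp (l * S a) * Real.exp (4 * l ^ 2) := by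
            refine Finset.sum_le_sum fun a _ => ?_
            rw [intervalIntegral.integral_const_mul]
            gcongr
            exact integral_exp_le (hg a N) (hb a N) (h0 a N) l
        _ = (∑ a ∈ A, Real.exp (l * S a)) * Real.exp (4 * l ^ 2) := by rw [Finset.sum_mul]
        _ ≤ (A.card * Real.exp (4 * l ^ 2) ^ N) * Real.exp (4 * l ^ 2) := by gcongr
        _ = _ := by rw [pow_succ (Real.exp _), mul_assoc]

/-- **Derandomised Hoeffding inequality.** Given finitely many families of functions of modulus at
most one, there are points at which all sums of deviations from the mean are of size
`O (√(N log #A))` simultaneously. -/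
lemma exists_norm_sum_sub_integral_le {ι : Type*} (A : Finset ι) (hA : A.Nonempty)
    (h : ι → ℕ → ℝ → ℂ) (hc : ∀ a m, ContinuousOn (h a m) (Icc 0 1))
    (hb : ∀ a m, ∀ t ∈ Icc (0 : ℝ) 1, ‖h a m t‖ ≤ 1) (N : ℕ) (hN : 0 < N) :
    ∃ t : ℕ → ℝ, (∀ m, t m ∈ Icc (0 : ℝ) 1) ∧ ∀ a ∈ A,
      ‖∑ m ∈ Finset.range N, (h a m (t m) - ∫ u in (0 : ℝ)..1, h a m u)‖ ≤
        10 * Real.sqrt (N * Real.log (4 * A.card)) := by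
  classical
  -- The real functions to control are `± Re` and `± Im` of the deviations.
  let L : Fin 4 → (ℂ →L[ℝ] ℝ) := ![Complex.reCLM, -Complex.reCLM, Complex.imCLM, -Complex.imCLM]
  have hL : ∀ i z, |L i z| ≤ ‖z‖ := by
    intro i z
    fin_cases i <;> simp [L, Complex.abs_re_le_norm, Complex.abs_im_le_norm]
  have hii : ∀ a m, IntervalIntegrable (h a m) volume 0 1 := fun a m =>
    ContinuousOn.intervalIntegrable (by rw [uIcc_of_le zero_le_one]; exact hc a m)
  set J : ι → ℕ → ℂ := fun a m => ∫ u in (0 : ℝ)..1, h a m u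
  have hJ : ∀ a m, ‖J a m‖ ≤ 1 := fun a m => by
    have := intervalIntegral.norm_integral_le_of_norm_le_const (a := 0) (b := 1) (f := h a m)
      (C := 1) fun t ht => hb a m t (by
        rw [uIoc_of_le zero_le_one] at ht
        exact ⟨ht.1.le, ht.2⟩)
    simpa using this
  set g : ι × Fin 4 → ℕ → ℝ → ℝ := fun p m t => L p.2 (h p.1 m t - J p.1 m)
  set Λ := Real.log (4 * A.card)
  have hAc : (1 : ℝ) ≤ A.card := by exact_mod_cast hA.card_pos
  have hΛ : 0 < Λ := Real.log_pos (by linarith)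
  have hNr : (0 : ℝ) < N := by exact_mod_cast hN
  -- This value of `l` makes the two contributions `Λ / l` and `4 * l * N` comparable.
  set l := Real.sqrt (Λ / N)
  have hl0 : 0 < l := Real.sqrt_pos.2 (by positivity)
  have hl2 : l ^ 2 * N = Λ := by
    rw [Real.sq_sqrt (by positivity)]
    field_simp
  have hgb : ∀ p m, ∀ t ∈ Icc (0 : ℝ) 1, |g p m t| ≤ 2 := fun p m t ht => by
    refine (hL _ _).trans ((norm_sub_le _ _).trans ?_)
    linarith [hb p.1 m t ht, hJ p.1 m]
  obtain ⟨t, ht, hsum⟩ := exists_potential_le (A ×ˢ (Finset.univ : Finset (Fin 4))) g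
    (fun p m => (L p.2).continuous.comp_continuousOn ((hc p.1 m).sub continuousOn_const)) hgb
    (fun p m => by
      change ∫ t in (0 : ℝ)..1, L p.2 (h p.1 m t - J p.1 m) = 0
      rw [ContinuousLinearMap.intervalIntegral_comp_comm _ ((hii _ _).sub (by simp)),
        intervalIntegral.integral_sub (hii _ _) (by simp)]
      simp [J]) l N
  refine ⟨t, ht, fun a ha => ?_⟩
  set S := ∑ m ∈ Finset.range N, (h a m (t m) - J a m)
  have hbound : ∀ i, L i S ≤ 5 * Real.sqrt (N * Λ) := by
    intro i
    have h1 : Real.exp (l * L i S) ≤ (4 * A.card) * Real.exp (4 * l ^ 2) ^ N := by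
      have h2 : Real.exp (l * ∑ m ∈ Finset.range N, g (a, i) m (t m)) ≤ _ :=
        (Finset.single_le_sum (f := fun p => Real.exp (l * ∑ m ∈ Finset.range N, g p m (t m)))
          (fun p _ => (Real.exp_pos _).le)
          (Finset.mem_product.2 ⟨ha, Finset.mem_univ i⟩)).trans hsum
      have h3 : L i S = ∑ m ∈ Finset.range N, g (a, i) m (t m) := map_sum _ _ _
      rw [h3]
      refine h2.trans_eq ?_
      simp [mul_comm]
    have h4 : l * L i S ≤ Λ + 4 * Λ := by
      have h5 := Real.log_le_log (Real.exp_pos _) h1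
      rw [Real.log_exp, Real.log_mul (by positivity) (by positivity), Real.log_pow,
        Real.log_exp] at h5
      change l * L i S ≤ Λ + N * (4 * l ^ 2) at h5
      nlinarith
    have h6 : l * Real.sqrt (N * Λ) = Λ := by
      rw [← Real.sqrt_mul (by positivity)]
      rw [show Λ / N * (N * Λ) = Λ ^ 2 by field_simp]
      exact Real.sqrt_sq hΛ.le
    nlinarith
  have hre : |S.re| ≤ 5 * Real.sqrt (N * Λ) := by
    have h0 : S.re ≤ _ := hbound 0
    have h1 : -S.re ≤ _ := hbound 1
    exact abs_le.2 ⟨by linarith, h0⟩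
  have him : |S.im| ≤ 5 * Real.sqrt (N * Λ) := by
    have h0 : S.im ≤ _ := hbound 2
    have h1 : -S.im ≤ _ := hbound 3
    exact abs_le.2 ⟨by linarith, h0⟩
  linarith [Complex.norm_le_abs_re_add_abs_im S]

/-! ### Jittered Cantor sets -/

/-- The length `2 ^ (-(n+1)²)` of the intervals of generation `n`. The ratios of consecutive lengths
grow, but `log (scale (n+1)) / log (scale n) → 1`. -/
noncomputable def scale (n : ℕ) : ℝ := (1 / 2) ^ ((n + 1) ^ 2)

lemma scale_pos (n : ℕ) : 0 < scale n := by unfold scale; positivity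

lemma scale_succ_mul (n : ℕ) : scale (n + 1) * 2 ^ (2 * n + 3) = scale n := by
  unfold scale
  rw [show (n + 1 + 1) ^ 2 = (n + 1) ^ 2 + (2 * n + 3) by ring, pow_add, mul_assoc, ← mul_pow]
  norm_num

lemma two_mul_scale_succ_le (n : ℕ) : 2 * scale (n + 1) ≤ scale n := by
  rw [← scale_succ_mul n]
  have : (2 : ℝ) ^ 1 ≤ 2 ^ (2 * n + 3) := pow_le_pow_right₀ (by norm_num) (by omega)
  nlinarith [scale_pos (n + 1)]

lemma scale_zero : scale 0 = 1 / 2 := by simp [scale]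

/-- The number of nodes of generation `n`, when every node of generation `j` has `T j` children. -/
def nodes (T : ℕ → ℕ) (n : ℕ) : ℕ := ∏ j ∈ Finset.range n, T j

/-- The displacement of the node `m` of generation `n + 1` from its parent, the node `m / T n` of
generation `n`: the `T n` children of a node are spread over an interval of length `scale n` divided
into `T n` equal cells, with the child `m % T n` at relative position `t n m` in its cell. -/
noncomputable def displacement (T : ℕ → ℕ) (t : ℕ → ℕ → ℝ) (n m : ℕ) : ℝ :=
  scale n * (((m % T n : ℕ) + t n m) / T n)

/-- The position of the node `m` of generation `n`. -/
noncomputable def position (T : ℕ → ℕ) (t : ℕ → ℕ → ℝ) : ℕ → ℕ → ℝ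
  | 0, _ => 1
  | n + 1, m => position T t n (m / T n) + displacement T t n m

/-- The parametrization of the limit set by `[0, 1)`: the node of generation `n` which is an ancestor
of `θ` is `⌊θ * nodes T n⌋₊`. -/
noncomputable def limitPoint (T : ℕ → ℕ) (t : ℕ → ℕ → ℝ) (θ : ℝ) : ℝ :=
  ⨆ n, position T t n ⌊θ * nodes T n⌋₊

/-- The natural probability measure on the limit set. -/
noncomputable def limitMeasure (T : ℕ → ℕ) (t : ℕ → ℕ → ℝ) : Measure ℝ :=
  (volume.restrict (Ico (0 : ℝ) 1)).map (limitPoint T t)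

/-- The closure of the limit set. -/
def limitSet (T : ℕ → ℕ) (t : ℕ → ℕ → ℝ) : Set ℝ := closure (limitPoint T t '' Ico 0 1)

section Tree

variable {T : ℕ → ℕ} {t : ℕ → ℕ → ℝ}

lemma nodes_succ (n : ℕ) : nodes T (n + 1) = nodes T n * T n := Finset.prod_range_succ _ _

lemma nodes_pos (hT : ∀ n, 0 < T n) (n : ℕ) : 0 < nodes T n := Finset.prod_pos fun j _ => hT j

lemma displacement_nonneg (ht : ∀ n m, t n m ∈ Icc (0 : ℝ) 1) (n m : ℕ) :
    0 ≤ displacement T t n m := by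
  have := (ht n m).1
  have := scale_pos n
  unfold displacement
  positivity

lemma displacement_le (hT : ∀ n, 0 < T n) (ht : ∀ n m, t n m ∈ Icc (0 : ℝ) 1) (n m : ℕ) :
    displacement T t n m ≤ scale n := by
  have h1 := (ht n m).2
  have h2 : ((m % T n : ℕ) : ℝ) + 1 ≤ T n := by exact_mod_cast Nat.mod_lt m (hT n)
  have h3 : (0 : ℝ) < T n := by exact_mod_cast hT n
  unfold displacement
  refine mul_le_of_le_one_right (scale_pos n).le ?_
  rw [div_le_one h3]
  linarith

lemma position_succ_floor (hT : ∀ n, 0 < T n) (n : ℕ) (θ : ℝ) :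
    position T t (n + 1) ⌊θ * nodes T (n + 1)⌋₊ = position T t n ⌊θ * nodes T n⌋₊ +
      displacement T t n ⌊θ * nodes T (n + 1)⌋₊ := by
  have h3 : (T n : ℝ) ≠ 0 := by exact_mod_cast (hT n).ne'
  rw [position, ← Nat.floor_div_natCast, nodes_succ]
  congr 3
  push_cast
  field_simp

lemma one_le_position (ht : ∀ n m, t n m ∈ Icc (0 : ℝ) 1) (n m : ℕ) : 1 ≤ position T t n m := by
  induction n generalizing m with
  | zero => simp [position]
  | succ n ih => rw [position]; linarith [ih (m / T n), displacement_nonneg (T := T) ht n m]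

lemma position_floor_le (hT : ∀ n, 0 < T n) (ht : ∀ n m, t n m ∈ Icc (0 : ℝ) 1) (θ : ℝ) (n j : ℕ) :
    position T t j ⌊θ * nodes T j⌋₊ ≤ position T t n ⌊θ * nodes T n⌋₊ + 2 * scale n := by
  have hmono : Monotone fun n => position T t n ⌊θ * nodes T n⌋₊ := monotone_nat_of_le_succ
    fun n => by
      rw [position_succ_floor hT]
      linarith [displacement_nonneg (T := T) ht n ⌊θ * nodes T (n + 1)⌋₊]
  have hanti : Antitone fun n => position T t n ⌊θ * nodes T n⌋₊ + 2 * scale n :=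
    antitone_nat_of_succ_le fun n => by
      rw [position_succ_floor hT]
      linarith [displacement_le hT ht n ⌊θ * nodes T (n + 1)⌋₊, two_mul_scale_succ_le n]
  rcases le_total j n with h | h
  · exact (hmono h).trans (by linarith [scale_pos n])
  · have h1 := hanti h
    dsimp only at h1
    linarith [scale_pos j]

lemma position_floor_le_limitPoint (hT : ∀ n, 0 < T n) (ht : ∀ n m, t n m ∈ Icc (0 : ℝ) 1)
    (θ : ℝ) (n : ℕ) : position T t n ⌊θ * nodes T n⌋₊ ≤ limitPoint T t θ :=
  le_ciSup (f := fun n => position T t n ⌊θ * nodes T n⌋₊)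
    ⟨_, by rintro _ ⟨j, rfl⟩; exact position_floor_le hT ht θ 0 j⟩ n

lemma limitPoint_le (hT : ∀ n, 0 < T n) (ht : ∀ n m, t n m ∈ Icc (0 : ℝ) 1) (θ : ℝ) (n : ℕ) :
    limitPoint T t θ ≤ position T t n ⌊θ * nodes T n⌋₊ + 2 * scale n :=
  ciSup_le fun j => position_floor_le hT ht θ n j

lemma limitPoint_mem_Icc (hT : ∀ n, 0 < T n) (ht : ∀ n m, t n m ∈ Icc (0 : ℝ) 1) (θ : ℝ) :
    limitPoint T t θ ∈ Icc 1 2 := by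
  have h1 := position_floor_le_limitPoint hT ht θ 0
  have h2 := limitPoint_le hT ht θ 0
  rw [position] at h1 h2
  rw [scale_zero] at h2
  exact ⟨h1, by linarith⟩

lemma measurable_limitPoint : Measurable (limitPoint T t) := by
  refine Measurable.iSup fun n => ?_
  exact (measurable_from_nat (f := position T t n)).comp
    (Nat.measurable_floor.comp (measurable_id.mul_const _))

instance : IsProbabilityMeasure (limitMeasure T t) := by
  have : IsProbabilityMeasure (volume.restrict (Ico (0 : ℝ) 1)) := ⟨by simp⟩
  exact Measure.isProbabilityMeasure_map measurable_limitPoint.aemeasurable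

lemma floor_mul_nodes_lt (hT : ∀ n, 0 < T n) {θ : ℝ} (hθ : θ ∈ Ico (0 : ℝ) 1) (n : ℕ) :
    ⌊θ * nodes T n⌋₊ < nodes T n := by
  have h3 : (0 : ℝ) < nodes T n := by exact_mod_cast nodes_pos hT n
  rw [Nat.floor_lt (mul_nonneg hθ.1 h3.le)]
  nlinarith [hθ.2]

lemma limitSet_subset_Icc (hT : ∀ n, 0 < T n) (ht : ∀ n m, t n m ∈ Icc (0 : ℝ) 1) :
    limitSet T t ⊆ Icc 1 2 :=
  closure_minimal (by rintro _ ⟨θ, -, rfl⟩; exact limitPoint_mem_Icc hT ht θ) isClosed_Icc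

lemma isCompact_limitSet (hT : ∀ n, 0 < T n) (ht : ∀ n m, t n m ∈ Icc (0 : ℝ) 1) :
    IsCompact (limitSet T t) :=
  isCompact_Icc.of_isClosed_subset isClosed_closure (limitSet_subset_Icc hT ht)

lemma limitSet_nonempty : (limitSet T t).Nonempty :=
  ⟨_, subset_closure ⟨0, by simp, rfl⟩⟩

lemma support_limitMeasure_subset : (limitMeasure T t).support ⊆ limitSet T t := by
  refine Measure.support_subset_of_isClosed isClosed_closure ?_
  refine (ae_map_iff measurable_limitPoint.aemeasurable isClosed_closure.measurableSet).2 ?_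
  filter_upwards [ae_restrict_mem measurableSet_Ico] with θ hθ
  exact subset_closure ⟨θ, hθ, rfl⟩

lemma limitSet_subset_iUnion (hT : ∀ n, 0 < T n) (ht : ∀ n m, t n m ∈ Icc (0 : ℝ) 1) (n : ℕ) :
    limitSet T t ⊆ ⋃ m : Fin (nodes T n),
      Icc (position T t n m) (position T t n m + 2 * scale n) := by
  refine closure_minimal ?_ (isClosed_iUnion_of_finite fun _ => isClosed_Icc)
  rintro _ ⟨θ, hθ, rfl⟩
  refine mem_iUnion.2 ⟨⟨_, floor_mul_nodes_lt hT hθ n⟩, ?_⟩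
  exact ⟨position_floor_le_limitPoint hT ht θ n, limitPoint_le hT ht θ n⟩

/-- At most five cells of a node meet an interval of the length of three intervals of the next
generation, since a cell is at least as long as those. -/
lemma card_position_mem_Icc_le (hT : ∀ n, 0 < T n) (hT' : ∀ n, T n ≤ 2 ^ (2 * n + 3))
    (ht : ∀ n m, t n m ∈ Icc (0 : ℝ) 1) (n : ℕ) (a : ℝ) :
    {m ∈ Finset.range (nodes T n) | position T t n m ∈ Icc a (a + 3 * scale n)}.card ≤ 5 ^ n := by
  induction n generalizing a with
  | zero => exact (Finset.card_filter_le _ _).trans (by simp [nodes])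
  | succ n ih =>
    set F := {m ∈ Finset.range (nodes T (n + 1)) |
      position T t (n + 1) m ∈ Icc a (a + 3 * scale (n + 1))}
    have hTr : (0 : ℝ) < T n := by exact_mod_cast hT n
    have hc := scale_pos n
    have hc' := scale_pos (n + 1)
    have hcT : scale (n + 1) * T n ≤ scale n := by
      rw [← scale_succ_mul n]
      gcongr
      exact_mod_cast hT' n
    have himage : F.image (· / T n) ⊆ {m ∈ Finset.range (nodes T n) |
        position T t n m ∈ Icc (a - scale n) (a - scale n + 3 * scale n)} := by
      intro v hv
      obtain ⟨m, hm, rfl⟩ := Finset.mem_image.1 hv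
      obtain ⟨hm1, hm2⟩ := Finset.mem_filter.1 hm
      rw [position] at hm2
      have h1 := displacement_nonneg (T := T) ht n m
      have h2 := displacement_le hT ht n m
      refine Finset.mem_filter.2 ⟨?_, ?_, ?_⟩
      · rw [Finset.mem_range, nodes_succ] at hm1
        exact Finset.mem_range.2 (Nat.div_lt_of_lt_mul (by rwa [mul_comm]))
      · linarith [hm2.1]
      · linarith [hm2.2, two_mul_scale_succ_le n]
    have hfiber : ∀ v ∈ F.image (· / T n), {m ∈ F | m / T n = v}.card ≤ 5 := by
      intro v _
      set b := (a - position T t n v) * T n / scale n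
      have hinj : Set.InjOn (· % T n) ({m ∈ F | m / T n = v} : Finset ℕ) := by
        intro m hm m' hm' h
        have h1 := (Finset.mem_filter.1 hm).2
        have h2 := (Finset.mem_filter.1 hm').2
        dsimp only at h
        rw [← Nat.div_add_mod m (T n), ← Nat.div_add_mod m' (T n), h, h1, h2]
      rw [← Finset.card_image_of_injOn hinj]
      refine (Finset.card_le_card (t := Finset.Icc ⌈b - 1⌉₊ (⌈b - 1⌉₊ + 4)) ?_).trans
        (by rw [Nat.card_Icc]; omega)
      intro i hi
      obtain ⟨m, hm, rfl⟩ := Finset.mem_image.1 hi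
      obtain ⟨hmF, rfl⟩ := Finset.mem_filter.1 hm
      have hm2 := (Finset.mem_filter.1 hmF).2
      rw [position, displacement] at hm2
      have htm := ht n m
      set i := m % T n
      have h5 : b ≤ i + t n m := by
        rw [div_le_iff₀ hc]
        have := hm2.1
        have h6 : a - position T t n (m / T n) ≤ scale n * ((i + t n m) / T n) := by linarith
        rw [← mul_div_assoc, le_div_iff₀ hTr] at h6
        linarith
      have h7 : i + t n m ≤ b + 3 := by
        have h6 : scale n * ((i + t n m) / T n) ≤
          a - position T t n (m / T n) + 3 * scale (n + 1) := by linarith [hm2.2]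
        rw [← mul_div_assoc, div_le_iff₀ hTr] at h6
        have h8 : (i + t n m) * scale n ≤
            (a - position T t n (m / T n)) * T n + 3 * scale n := by nlinarith
        have h9 : b + 3 = ((a - position T t n (m / T n)) * T n + 3 * scale n) / scale n := by
          simp only [b]
          field_simp
        rw [h9, le_div_iff₀ hc]
        exact h8
      refine Finset.mem_Icc.2 ⟨Nat.ceil_le.2 (by linarith [htm.2]), ?_⟩
      have h10 : (i : ℝ) ≤ ⌈b - 1⌉₊ + 4 := by linarith [Nat.le_ceil (b - 1), htm.1]
      exact_mod_cast h10
    calc F.card ≤ 5 * (F.image (· / T n)).card :=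
          Finset.card_le_mul_card_image _ 5 hfiber
      _ ≤ 5 * 5 ^ n := by
          gcongr
          exact (Finset.card_le_card himage).trans (ih _)
      _ = _ := by ring

/-- The limit measure of an interval of the length of one of generation `n`. -/
lemma limitMeasure_Icc_le (hT : ∀ n, 0 < T n) (hT' : ∀ n, T n ≤ 2 ^ (2 * n + 3))
    (ht : ∀ n m, t n m ∈ Icc (0 : ℝ) 1) (n : ℕ) (a : ℝ) :
    limitMeasure T t (Icc a (a + scale n)) ≤ ENNReal.ofReal (5 ^ n / nodes T n) := by
  set N := nodes T n
  have hN : (0 : ℝ) < N := by exact_mod_cast nodes_pos hT n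
  set F := {m ∈ Finset.range N |
    position T t n m ∈ Icc (a - 2 * scale n) (a - 2 * scale n + 3 * scale n)}
  have hsub : limitPoint T t ⁻¹' (Icc a (a + scale n)) ∩ Ico 0 1 ⊆
      ⋃ m ∈ F, Ico ((m : ℝ) / N) ((m + 1) / N) := by
    rintro θ ⟨hθ1, hθ2⟩
    have h1 := position_floor_le_limitPoint hT ht θ n
    have h2 := limitPoint_le hT ht θ n
    have h3 : 0 ≤ θ * N := mul_nonneg hθ2.1 hN.le
    refine mem_iUnion₂.2 ⟨⌊θ * N⌋₊, Finset.mem_filter.2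
      ⟨Finset.mem_range.2 (floor_mul_nodes_lt hT hθ2 n), ?_, ?_⟩, ?_, ?_⟩
    · linarith [hθ1.1]
    · linarith [hθ1.2]
    · rw [div_le_iff₀ hN]
      exact Nat.floor_le h3
    · rw [lt_div_iff₀ hN]
      exact Nat.lt_floor_add_one _
  rw [limitMeasure, Measure.map_apply measurable_limitPoint measurableSet_Icc,
    Measure.restrict_apply (measurable_limitPoint measurableSet_Icc)]
  calc _ ≤ ∑ m ∈ F, volume (Ico ((m : ℝ) / N) ((m + 1) / N)) :=
        (measure_mono hsub).trans (measure_biUnion_finset_le _ _)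
    _ = ∑ m ∈ F, ENNReal.ofReal (1 / N) := by
        refine Finset.sum_congr rfl fun m _ => ?_
        rw [Real.volume_Ico]
        congr 1
        ring
    _ = ENNReal.ofReal (F.card / N) := by
        rw [Finset.sum_const, nsmul_eq_mul, ← ENNReal.ofReal_natCast,
          ← ENNReal.ofReal_mul (by positivity)]
        congr 1
        ring
    _ ≤ _ := by
        refine ENNReal.ofReal_le_ofReal ?_
        gcongr
        exact_mod_cast card_position_mem_Icc_le hT hT' ht n _

/-- Averaging over the cells of a division of `[0, 1]`. -/
lemma sum_integral_cells {T : ℕ} (hT : 0 < T) {f : ℝ → ℂ}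
    (hf : IntervalIntegrable f volume 0 1) :
    ∑ i ∈ Finset.range T, ∫ u in (0 : ℝ)..1, f ((i + u) / T) = T * ∫ u in (0 : ℝ)..1, f u := by
  have hTr : (0 : ℝ) < T := by exact_mod_cast hT
  have h1 : ∀ i : ℕ, ∫ u in (0 : ℝ)..1, f ((i + u) / T) =
      T * ∫ u in ((i : ℕ) / (T : ℝ))..((i + 1 : ℕ) / (T : ℝ)), f u := by
    intro i
    have := intervalIntegral.integral_comp_add_div (a := 0) (b := 1) f hTr.ne' (i / T : ℝ)
    simp only [zero_div, add_zero] at this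
    rw [show ((i + 1 : ℕ) / (T : ℝ)) = i / T + 1 / T by push_cast; ring]
    rw [Complex.real_smul] at this
    rw [Complex.ofReal_natCast] at this
    rw [← this]
    congr 1
    ext u
    congr 1
    ring
  simp_rw [h1]
  rw [← Finset.mul_sum, intervalIntegral.sum_integral_adjacent_intervals]
  · simp [hTr.ne']
  · intro k hk
    refine hf.mono_set ?_
    rw [uIcc_of_le zero_le_one, uIcc_of_le (by gcongr; simp)]
    refine Icc_subset_Icc (by positivity) ?_
    rw [div_le_one hTr]
    exact_mod_cast hk

lemma integral_limitMeasure {f : ℝ → ℂ} (hf : Measurable f) :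
    ∫ x, f x ∂(limitMeasure T t) = ∫ θ in (0 : ℝ)..1, f (limitPoint T t θ) := by
  rw [limitMeasure, integral_map measurable_limitPoint.aemeasurable hf.aestronglyMeasurable,
    intervalIntegral.integral_of_le zero_le_one, integral_Ico_eq_integral_Ioc]

/-- A function of the node containing `θ` has the average over the nodes as its integral. -/
lemma integral_floor_mul (f : ℕ → ℂ) {N : ℕ} (hN : 0 < N) :
    ∫ θ in (0 : ℝ)..1, f ⌊θ * N⌋₊ = (N : ℂ)⁻¹ * ∑ m ∈ Finset.range N, f m := by
  have hNr : (0 : ℝ) < N := by exact_mod_cast hN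
  have hint : IntervalIntegrable (fun θ : ℝ => f ⌊θ * N⌋₊) volume 0 1 := by
    rw [intervalIntegrable_iff_integrableOn_Ioc_of_le zero_le_one]
    refine Measure.integrableOn_of_bounded (M := ∑ m ∈ Finset.range (N + 1), ‖f m‖) (by simp)
      ((measurable_from_nat (f := f)).comp
        (Nat.measurable_floor.comp (measurable_id.mul_const _))).aestronglyMeasurable ?_
    filter_upwards [ae_restrict_mem measurableSet_Ioc] with θ hθ
    refine Finset.single_le_sum (f := fun m => ‖f m‖) (fun _ _ => norm_nonneg _) ?_
    rw [Finset.mem_range, Nat.lt_succ_iff]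
    refine Nat.floor_le_of_le ?_
    nlinarith [hθ.2]
  have h1 := sum_integral_cells hN hint
  have h2 : ∀ i : ℕ, ∫ u in (0 : ℝ)..1, f ⌊(i + u) / N * (N : ℝ)⌋₊ = f i := by
    intro i
    rw [intervalIntegral.integral_of_le zero_le_one, ← integral_Ico_eq_integral_Ioc,
      setIntegral_congr_fun (g := fun _ => f i) measurableSet_Ico]
    · simp
    · intro u hu
      dsimp only
      rw [div_mul_cancel₀ _ hNr.ne', Nat.floor_eq_iff (add_nonneg (by positivity) hu.1) |>.2]
      exact ⟨by linarith [hu.1], by linarith [hu.2]⟩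
  simp_rw [h2] at h1
  rw [h1, ← mul_assoc, inv_mul_cancel₀ (by exact_mod_cast hN.ne'), one_mul]

end Tree

/-! ### Choosing the jitter -/

/-- The average of `f` over the nodes of generation `n`. -/
noncomputable def nodeAverage (T : ℕ → ℕ) (t : ℕ → ℕ → ℝ) (n : ℕ) (f : ℝ → ℂ) : ℂ :=
  (nodes T n : ℂ)⁻¹ * ∑ m ∈ Finset.range (nodes T n), f (position T t n m)

lemma sum_range_mul_div_mod {M : Type*} [AddCommMonoid M] (f : ℕ → ℕ → M) (N : ℕ) {T : ℕ}
    (hT : 0 < T) : ∑ m ∈ Finset.range (N * T), f (m / T) (m % T) =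
      ∑ v ∈ Finset.range N, ∑ i ∈ Finset.range T, f v i := by
  induction N with
  | zero => simp
  | succ N ih =>
    rw [add_mul, one_mul, Finset.sum_range_add, ih, Finset.sum_range_succ]
    congr 1
    refine Finset.sum_congr rfl fun i hi => ?_
    have hi := Finset.mem_range.1 hi
    rw [mul_comm, Nat.mul_add_div hT, Nat.mul_add_mod, Nat.div_eq_of_lt hi, Nat.mod_eq_of_lt hi,
      add_zero]

/-- One step of the construction: the nodes of generation `n + 1` can be placed so that the averages
of finitely many given functions change by little more than the reciprocal of the square root of the
number of nodes, compared with their conditional expectations. -/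
lemma exists_jitter_step {ι : Type*} {A : Finset ι} (hA : A.Nonempty) {g : ι → ℝ → ℂ}
    (hg : ∀ a, Continuous (g a)) (hb : ∀ a x, 1 ≤ x → ‖g a x‖ ≤ 1) {N T : ℕ} (hN : 0 < N)
    (hT : 0 < T) {c : ℝ} (hc : 0 ≤ c) (p : ℕ → ℝ) (hp : ∀ m, 1 ≤ p m) :
    ∃ τ : ℕ → ℝ, (∀ m, τ m ∈ Icc (0 : ℝ) 1) ∧ ∀ a ∈ A,
      ‖((N * T : ℕ) : ℂ)⁻¹ * ∑ m ∈ Finset.range (N * T),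
          g a (p (m / T) + c * (((m % T : ℕ) + τ m) / T)) -
        (N : ℂ)⁻¹ * ∑ m ∈ Finset.range N, ∫ u in (0 : ℝ)..1, g a (p m + c * u)‖ ≤
      10 * Real.sqrt (Real.log (4 * A.card) / (N * T : ℕ)) := by
  have hNT : 0 < N * T := Nat.mul_pos hN hT
  have hTc : (T : ℂ) ≠ 0 := by exact_mod_cast hT.ne'
  have hNc : (N : ℂ) ≠ 0 := by exact_mod_cast hN.ne'
  obtain ⟨τ, hτ, h⟩ := exists_norm_sum_sub_integral_le A hA
    (fun a m u => g a (p (m / T) + c * (((m % T : ℕ) + u) / T)))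
    (fun a m => by have := hg a; fun_prop)
    (fun a m u hu => hb a _ (by
      have := hp (m / T)
      have := hu.1
      have : 0 ≤ c * (((m % T : ℕ) + u) / T) := by positivity
      linarith)) (N * T) hNT
  refine ⟨τ, hτ, fun a ha => ?_⟩
  have h1 := h a ha
  rw [Finset.sum_sub_distrib,
    sum_range_mul_div_mod (fun v i => ∫ u in (0 : ℝ)..1, g a (p v + c * ((i + u) / T))) N hT] at h1
  have h2 : ∀ v, ∑ i ∈ Finset.range T, ∫ u in (0 : ℝ)..1, g a (p v + c * ((i + u) / T)) =
      T * ∫ u in (0 : ℝ)..1, g a (p v + c * u) := fun v =>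
    sum_integral_cells hT (f := fun u => g a (p v + c * u))
      (Continuous.intervalIntegrable (by have := hg a; fun_prop) _ _)
  simp_rw [h2] at h1
  rw [← Finset.mul_sum] at h1
  set S := ∑ m ∈ Finset.range (N * T), g a (p (m / T) + c * (((m % T : ℕ) + τ m) / T))
  set I := ∑ v ∈ Finset.range N, ∫ u in (0 : ℝ)..1, g a (p v + c * u)
  have h3 : ((N * T : ℕ) : ℂ)⁻¹ * S - (N : ℂ)⁻¹ * I = ((N * T : ℕ) : ℂ)⁻¹ * (S - T * I) := by
    push_cast
    field_simp
  have hNTr : (0 : ℝ) < (N * T : ℕ) := by exact_mod_cast hNT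
  rw [h3, norm_mul, norm_inv, Complex.norm_natCast]
  refine (mul_le_mul_of_nonneg_left h1 (by positivity)).trans_eq ?_
  rw [Real.sqrt_mul hNTr.le, Real.sqrt_div' _ hNTr.le]
  have := Real.sqrt_pos.2 hNTr
  field_simp
  rw [Real.sq_sqrt hNTr.le]

/-- The steps are iterated, each with its own finite family of functions. The inner integral is the
conditional expectation of `g n a` at a uniformly chosen child of a node at `x`. -/
theorem exists_jitter {ι : Type*} {T : ℕ → ℕ} (hT : ∀ n, 0 < T n) {A : ℕ → Finset ι}
    (hA : ∀ n, (A n).Nonempty) {g : ℕ → ι → ℝ → ℂ} (hg : ∀ n a, Continuous (g n a))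
    (hb : ∀ n a x, 1 ≤ x → ‖g n a x‖ ≤ 1) :
    ∃ t : ℕ → ℕ → ℝ, (∀ n m, t n m ∈ Icc (0 : ℝ) 1) ∧ ∀ n, ∀ a ∈ A n,
      ‖nodeAverage T t (n + 1) (g n a) -
        nodeAverage T t n (fun x => ∫ u in (0 : ℝ)..1, g n a (x + scale n * u))‖ ≤
      10 * Real.sqrt (Real.log (4 * (A n).card) / nodes T (n + 1)) := by
  have hstep : ∀ (n : ℕ) (p : ℕ → ℝ), ∃ τ : ℕ → ℝ, (∀ m, τ m ∈ Icc (0 : ℝ) 1) ∧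
      ((∀ m, 1 ≤ p m) → ∀ a ∈ A n,
      ‖((nodes T n * T n : ℕ) : ℂ)⁻¹ * ∑ m ∈ Finset.range (nodes T n * T n),
          g n a (p (m / T n) + scale n * (((m % T n : ℕ) + τ m) / T n)) -
        (nodes T n : ℂ)⁻¹ * ∑ m ∈ Finset.range (nodes T n),
          ∫ u in (0 : ℝ)..1, g n a (p m + scale n * u)‖ ≤
      10 * Real.sqrt (Real.log (4 * (A n).card) / (nodes T n * T n : ℕ))) := by
    intro n p
    by_cases hp : ∀ m, 1 ≤ p m
    · obtain ⟨τ, h1, h2⟩ := exists_jitter_step (hA n) (hg n) (hb n) (nodes_pos hT n) (hT n)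
        (scale_pos n).le p hp
      exact ⟨τ, h1, fun _ => h2⟩
    · exact ⟨fun _ => 0, fun _ => by simp, fun h => absurd h hp⟩
  choose τ hτ hbound using hstep
  let P : ℕ → ℕ → ℝ := fun n => Nat.rec (fun _ => 1) (fun n p m =>
    p (m / T n) + scale n * (((m % T n : ℕ) + τ n p m) / T n)) n
  have hpos : ∀ n m, position T (fun n m => τ n (P n) m) n m = P n m := by
    intro n
    induction n with
    | zero => intro m; rfl
    | succ n ih => intro m; rw [position, ih, displacement]
  have ht : ∀ n m, τ n (P n) m ∈ Icc (0 : ℝ) 1 := fun n m => hτ n (P n) m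
  refine ⟨fun n m => τ n (P n) m, ht, fun n a ha => ?_⟩
  have := hbound n (P n) (fun m => by rw [← hpos]; exact one_le_position ht n m) a ha
  unfold nodeAverage
  simp_rw [hpos, nodes_succ]
  exact this

/-! ### Smoothed Fourier transforms -/

/-- The Fourier transform of the uniform distribution on `[0, c]`. -/
noncomputable def uniformHat (c η : ℝ) : ℂ := ∫ u in (0 : ℝ)..1, fexp (c * u * η)

lemma norm_uniformHat_le_one (c η : ℝ) : ‖uniformHat c η‖ ≤ 1 := by
  have := intervalIntegral.norm_integral_le_of_norm_le_const (a := 0) (b := 1)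
    (f := fun u => fexp (c * u * η)) (C := 1) fun t _ => (norm_fexp _).le
  simpa [uniformHat] using this

lemma norm_uniformHat_le {c η : ℝ} (h : c * η ≠ 0) : ‖uniformHat c η‖ ≤ 1 / |c * η| := by
  have hz : ((-2 * Real.pi * (c * η) : ℝ) * Complex.I : ℂ) ≠ 0 := by
    refine mul_ne_zero ?_ Complex.I_ne_zero
    exact_mod_cast mul_ne_zero (by simp [Real.pi_ne_zero]) h
  have h1 : uniformHat c η = (fexp (c * η) - 1) / ((-2 * Real.pi * (c * η) : ℝ) * Complex.I) := by
    have := integral_exp_mul_complex (a := 0) (b := 1) hz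
    simp only [Complex.ofReal_one, mul_one, Complex.ofReal_zero, mul_zero, Complex.exp_zero] at this
    rw [fexp, ← this, uniformHat]
    congr 1
    ext u
    rw [fexp]
    congr 1
    push_cast
    ring
  rw [h1, norm_div, norm_mul, Complex.norm_I, mul_one, Complex.norm_real, Real.norm_eq_abs, abs_mul,
    div_le_div_iff₀ (by positivity) (by positivity), one_mul]
  have h2 : ‖fexp (c * η) - 1‖ ≤ 2 := by
    refine (norm_sub_le _ _).trans ?_
    rw [norm_fexp, norm_one]
    norm_num
  have h3 : (2 : ℝ) ≤ |-2 * Real.pi| := by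
    rw [abs_mul, abs_neg, abs_two, abs_of_pos Real.pi_pos]
    linarith [Real.pi_gt_three]
  gcongr
  exact h2.trans h3

lemma continuous_uniformHat (c : ℝ) : Continuous (uniformHat c) := by
  unfold uniformHat
  exact intervalIntegral.continuous_parametric_intervalIntegral_of_continuous' (by fun_prop) 0 1

/-- The average of `measureHat ν (ξ * (x + ρ))`, where `ρ` is a sum of independent random variables
uniformly distributed on the intervals `[0, scale j]`, `n ≤ j < k`. This is the conditional
expectation of `measureHat ν (ξ * x')`, given that `x` is the ancestor of generation `n` of a random
node `x'` of generation `k`. -/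
noncomputable def smoothedHat (ν : Measure ℝ) (ξ : ℝ) (k n : ℕ) (x : ℝ) : ℂ :=
  ∫ y, fexp (x * y * ξ) * ∏ j ∈ Finset.Ico n k, uniformHat (scale j) (y * ξ) ∂ν

lemma smoothedHat_of_le {ν : Measure ℝ} {k n : ℕ} (h : k ≤ n) (ξ x : ℝ) :
    smoothedHat ν ξ k n x = measureHat ν (x * ξ) := by
  rw [smoothedHat, measureHat_eq_integral_fexp, Finset.Ico_eq_empty_of_le h]
  congr 1
  ext y
  rw [Finset.prod_empty, mul_one]
  congr 1
  ring

lemma norm_prod_uniformHat_le (n k : ℕ) (η : ℝ) :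
    ‖∏ j ∈ Finset.Ico n k, uniformHat (scale j) η‖ ≤ 1 := by
  rw [norm_prod]
  exact Finset.prod_le_one (fun _ _ => norm_nonneg _) fun j _ => norm_uniformHat_le_one _ _

lemma continuous_prod_uniformHat (n k : ℕ) (ξ : ℝ) :
    Continuous fun y : ℝ => ∏ j ∈ Finset.Ico n k, uniformHat (scale j) (y * ξ) :=
  continuous_finsetProd _ fun j _ => (continuous_uniformHat _).comp (by fun_prop)

section Smoothed

variable {ν : Measure ℝ} [IsFiniteMeasure ν]

lemma continuous_smoothedHat (ξ : ℝ) (k n : ℕ) : Continuous (smoothedHat ν ξ k n) := by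
  have hp := continuous_prod_uniformHat n k ξ
  refine continuous_of_dominated (bound := fun _ => 1)
    (fun x => Continuous.aestronglyMeasurable (by fun_prop))
    (fun x => Eventually.of_forall fun y => ?_) (integrable_const _)
    (Eventually.of_forall fun y => by fun_prop)
  rw [norm_mul, norm_fexp, one_mul]
  exact norm_prod_uniformHat_le n k _

lemma smoothedHat_eq_integral {k n : ℕ} (h : n < k) (ξ x : ℝ) :
    smoothedHat ν ξ k n x = ∫ u in (0 : ℝ)..1, smoothedHat ν ξ k (n + 1) (x + scale n * u) := by
  have hp := continuous_prod_uniformHat (n + 1) k ξ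
  simp only [smoothedHat]
  rw [intervalIntegral_integral_swap]
  · congr 1
    ext y
    rw [intervalIntegral.integral_mul_const, Finset.prod_eq_prod_Ico_succ_bot h, ← mul_assoc,
      uniformHat, ← intervalIntegral.integral_const_mul]
    congr 1
    refine intervalIntegral.integral_congr fun u _ => ?_
    rw [← fexp_add]
    congr 1
    ring
  · have : IsFiniteMeasure ((volume : Measure ℝ).restrict (uIoc 0 1)) := ⟨by simp⟩
    refine Integrable.of_bound (C := 1) (Continuous.aestronglyMeasurable ?_) ?_
    · unfold Function.uncurry
      have hp' : Continuous fun p : ℝ × ℝ =>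
          ∏ j ∈ Finset.Ico (n + 1) k, uniformHat (scale j) (p.2 * ξ) := hp.comp continuous_snd
      fun_prop
    · refine Eventually.of_forall fun p => ?_
      rw [Function.uncurry, norm_mul, norm_fexp, one_mul]
      exact norm_prod_uniformHat_le _ k _

lemma norm_smoothedHat_le {ξ B : ℝ} (hB : ∀ x, 1 ≤ x → ‖measureHat ν (x * ξ)‖ ≤ B) (k n : ℕ)
    {x : ℝ} (hx : 1 ≤ x) : ‖smoothedHat ν ξ k n x‖ ≤ B := by
  rcases le_total k n with h | h
  · rw [smoothedHat_of_le h]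
    exact hB x hx
  · induction h using Nat.decreasingInduction generalizing x with
    | self =>
      rw [smoothedHat_of_le le_rfl]
      exact hB x hx
    | of_succ n h ih =>
      rw [smoothedHat_eq_integral h]
      have := intervalIntegral.norm_integral_le_of_norm_le_const (a := 0) (b := 1)
        (f := fun u => smoothedHat ν ξ k (n + 1) (x + scale n * u)) (C := B) fun u hu => by
          rw [uIoc_of_le zero_le_one] at hu
          have := mul_nonneg (scale_pos n).le hu.1.le
          exact ih (by linarith)
      simpa using this

/-- Every scale `scale j` with `n ≤ j < n + K` at which the smoothing acts contributes a factor
`1 / (scale j * |ξ|)`. -/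
lemma norm_smoothedHat_le_pow {δ ξ r : ℝ} (hδ : 0 < δ) (hν : ∀ᵐ y ∂ν, δ ≤ |y|) (hξ : 0 < ξ)
    {k n K : ℕ} (hK : n + K ≤ k) (hr : ∀ j < n + K, 1 / (scale j * ξ) ≤ r) (x : ℝ) :
    ‖smoothedHat ν ξ k n x‖ ≤ (r / δ) ^ K * ν.real univ := by
  refine norm_integral_le_of_norm_le_const ?_
  filter_upwards [hν] with y hy
  rw [norm_mul, norm_fexp, one_mul,
    ← Finset.prod_Ico_consecutive _ (Nat.le_add_right n K) hK, norm_mul]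
  refine (mul_le_of_le_one_right (norm_nonneg _) (norm_prod_uniformHat_le _ _ _)).trans ?_
  rw [norm_prod]
  refine (Finset.prod_le_prod (g := fun _ => r / δ) (fun _ _ => norm_nonneg _)
    fun j hj => ?_).trans_eq (by simp [div_pow])
  have hc := scale_pos j
  have hy0 : 0 < |y| := hδ.trans_le hy
  have hne : scale j * (y * ξ) ≠ 0 := mul_ne_zero hc.ne' (mul_ne_zero (abs_pos.1 hy0) hξ.ne')
  refine (norm_uniformHat_le hne).trans ?_
  have h1 := hr j (Finset.mem_Ico.1 hj).2
  rw [abs_mul, abs_mul, abs_of_pos hc, abs_of_pos hξ]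
  calc 1 / (scale j * (|y| * ξ)) = 1 / (scale j * ξ) / |y| := by field_simp
    _ ≤ r / δ := by
      have : 0 ≤ r := le_trans (by positivity) h1
      gcongr

end Smoothed

/-- The number of frequencies `√k` that are controlled when generation `n + 1` is chosen. They go beyond
`1 / scale n` by a fixed power, but their number enters only through its logarithm. -/
@[irreducible]
def frequencyBound (n : ℕ) : ℕ := 2 ^ (16 * (n + 1) ^ 2)

lemma one_le_frequencyBound (n : ℕ) : 1 ≤ frequencyBound n := by
  unfold frequencyBound
  exact Nat.one_le_two_pow

lemma cast_frequencyBound (n : ℕ) : (frequencyBound n : ℝ) = 2 ^ (16 * (n + 1) ^ 2) := by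
  unfold frequencyBound
  exact Nat.cast_pow 2 _

lemma log_frequencyBound_le (n : ℕ) :
    Real.log (4 * ((n + 1 : ℕ) * (frequencyBound n + 1 : ℕ))) ≤ 20 * (n + 1) ^ 2 := by
  have hF : (1 : ℝ) ≤ frequencyBound n := by exact_mod_cast one_le_frequencyBound n
  have h1 : Real.log (frequencyBound n) ≤ 16 * (n + 1) ^ 2 := by
    rw [cast_frequencyBound, Real.log_pow]
    have := Real.log_two_lt_d9
    push_cast
    nlinarith [sq_nonneg ((n : ℝ) + 1)]
  generalize (frequencyBound n) = F at *
  rw [Real.log_mul (by norm_num) (by positivity), Real.log_mul (by positivity) (by positivity)]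
  have h2 : Real.log (4 : ℝ) ≤ 4 - 1 := Real.log_le_sub_one_of_pos (by norm_num)
  have h3 : Real.log ((n + 1 : ℕ) : ℝ) ≤ (n + 1 : ℕ) - 1 :=
    Real.log_le_sub_one_of_pos (by positivity)
  have h4 : Real.log ((F + 1 : ℕ) : ℝ) ≤ 1 + Real.log F := by
    have h5 : ((F + 1 : ℕ) : ℝ) ≤ 2 * F := by push_cast; linarith
    have h6 := Real.log_le_log (by positivity) h5
    rw [Real.log_mul (by norm_num) (by linarith)] at h6
    linarith [Real.log_two_lt_d9]
  push_cast at h3 h4 ⊢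
  nlinarith [sq_nonneg (n : ℝ), (Nat.cast_nonneg n : (0 : ℝ) ≤ n)]

/-- Given countably many measures with Fourier decay, the tree can be chosen such that all the
relevant averages of smoothed Fourier transforms change in each generation by little more than the
reciprocal of the square root of the number of nodes. -/
theorem exists_controlled_tree {T : ℕ → ℕ} (hT : ∀ n, 0 < T n) (ν : ℕ → Measure ℝ)
    [∀ i, IsFiniteMeasure (ν i)] {C s : ℕ → ℝ} (hC : ∀ i, 0 < C i) (hs : ∀ i, 0 ≤ s i)
    (hν : ∀ i ξ, ‖measureHat (ν i) ξ‖ ≤ C i * (1 + |ξ|) ^ (-(s i / 2))) :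
    ∃ t : ℕ → ℕ → ℝ, (∀ n m, t n m ∈ Icc (0 : ℝ) 1) ∧
      ∀ i n k : ℕ, i ≤ n → n < k → k ≤ frequencyBound n →
        ‖nodeAverage T t (n + 1) (smoothedHat (ν i) (Real.sqrt k) k (n + 1)) -
          nodeAverage T t n (smoothedHat (ν i) (Real.sqrt k) k n)‖ ≤
        C i * (1 + Real.sqrt k) ^ (-(s i / 2)) *
          (50 * ((n + 1) / Real.sqrt (nodes T (n + 1)))) := by
  set B : ℕ × ℕ → ℝ := fun a => C a.1 * (1 + Real.sqrt a.2) ^ (-(s a.1 / 2))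
  have hB : ∀ a, 0 < B a := fun a => mul_pos (hC _) (by positivity)
  have hG : ∀ a : ℕ × ℕ, ∀ n x, 1 ≤ x → ‖smoothedHat (ν a.1) (Real.sqrt a.2) a.2 n x‖ ≤ B a := by
    intro a n x hx
    refine norm_smoothedHat_le (fun x hx => (hν _ _).trans ?_) _ _ hx
    have h0 := Real.sqrt_nonneg (a.2 : ℝ)
    have h1 : Real.sqrt a.2 ≤ |x * Real.sqrt a.2| := by
      rw [abs_mul, abs_of_nonneg h0, abs_of_nonneg (by linarith)]
      nlinarith
    exact mul_le_mul_of_nonneg_left (Real.rpow_le_rpow_of_nonpos (by positivity) (by linarith)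
      (by linarith [hs a.1])) (hC _).le
  obtain ⟨t, ht, h⟩ := exists_jitter hT
    (A := fun n => Finset.range (n + 1) ×ˢ Finset.range (frequencyBound n + 1))
    (fun n => ⟨(0, 0), by simp⟩)
    (g := fun n a x => (B a : ℂ)⁻¹ * smoothedHat (ν a.1) (Real.sqrt a.2) a.2 (n + 1) x)
    (fun n a => continuous_const.mul (continuous_smoothedHat _ _ _))
    (fun n a x hx => by
      rw [norm_mul, norm_inv, Complex.norm_real, Real.norm_of_nonneg (hB a).le,
        inv_mul_le_iff₀ (hB a), mul_one]
      exact hG a _ x hx)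
  refine ⟨t, ht, fun i n k hi hn hk => ?_⟩
  have h1 := h n (i, k) (Finset.mem_product.2 ⟨by simpa using by omega, by simpa using by omega⟩)
  simp_rw [intervalIntegral.integral_const_mul, ← smoothedHat_eq_integral hn] at h1
  have h2 : ∀ (z : ℂ) n f, nodeAverage T t n (fun x => z * f x) = z * nodeAverage T t n f := by
    intro z n f
    simp only [nodeAverage, ← Finset.mul_sum]
    ring
  rw [h2, h2, ← mul_sub, norm_mul, norm_inv, Complex.norm_real, Real.norm_of_nonneg (hB _).le,
    inv_mul_le_iff₀ (hB _)] at h1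
  refine h1.trans (mul_le_mul_of_nonneg_left ?_ (hB _).le)
  have hN : (0 : ℝ) < nodes T (n + 1) := by exact_mod_cast nodes_pos hT (n + 1)
  rw [Finset.card_product, Finset.card_range, Finset.card_range, Real.sqrt_div' _ hN.le,
    Nat.cast_mul]
  have h3 : Real.sqrt (Real.log (4 * ((n + 1 : ℕ) * (frequencyBound n + 1 : ℕ)))) ≤
      5 * (n + 1) := by
    refine Real.sqrt_le_iff.2 ⟨by positivity, (log_frequencyBound_le n).trans ?_⟩
    nlinarith [sq_nonneg ((n : ℝ) + 1)]
  have hs := Real.sqrt_pos.2 hN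
  calc _ ≤ 10 * (5 * (n + 1) / Real.sqrt (nodes T (n + 1))) := by gcongr
    _ = _ := by ring

/-! ### Fourier decay of the products -/

lemma scale_eq_rpow (n : ℕ) : scale n = (2 : ℝ) ^ (-((n : ℝ) + 1) ^ 2) := by
  rw [scale, Real.rpow_neg (by norm_num), one_div, inv_pow]
  congr 1
  rw [← Real.rpow_natCast]
  congr 1
  push_cast
  ring

section Tree

variable {T : ℕ → ℕ} {t : ℕ → ℕ → ℝ}

lemma two_rpow_mul_branching (α : ℝ) (n : ℕ) :
    (2 : ℝ) ^ (α * ((((n + 1 : ℕ) : ℝ) + 1) ^ 2 - 1)) =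
      (2 : ℝ) ^ (α * (((n : ℝ) + 1) ^ 2 - 1)) * ((2 : ℝ) ^ (2 * n + 3)) ^ α := by
  rw [← Real.rpow_natCast 2 (2 * n + 3), ← Real.rpow_mul (by norm_num),
    ← Real.rpow_add (by norm_num)]
  congr 1
  push_cast
  ring

lemma rpow_le_nodes {α : ℝ} (hTα : ∀ n, ((2 : ℝ) ^ (2 * n + 3)) ^ α ≤ T n) (n : ℕ) :
    (2 : ℝ) ^ (α * (((n : ℝ) + 1) ^ 2 - 1)) ≤ nodes T n := by
  induction n with
  | zero => simp [nodes]
  | succ n ih =>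
    rw [nodes_succ, Nat.cast_mul, two_rpow_mul_branching]
    have := hTα n
    gcongr

lemma nodes_le_rpow {α : ℝ} (hTα : ∀ n, (T n : ℝ) ≤ 4 * ((2 : ℝ) ^ (2 * n + 3)) ^ α) (n : ℕ) :
    (nodes T n : ℝ) ≤ 4 ^ n * (2 : ℝ) ^ (α * (((n : ℝ) + 1) ^ 2 - 1)) := by
  induction n with
  | zero => simp [nodes]
  | succ n ih =>
    rw [nodes_succ, Nat.cast_mul, two_rpow_mul_branching, pow_succ, mul_mul_mul_comm]
    have := hTα n
    gcongr

lemma norm_nodeAverage_le (hT : ∀ n, 0 < T n) {n : ℕ} {f : ℝ → ℂ} {B : ℝ}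
    (hf : ∀ x, ‖f x‖ ≤ B) : ‖nodeAverage T t n f‖ ≤ B := by
  have hN : (0 : ℝ) < nodes T n := by exact_mod_cast nodes_pos hT n
  rw [nodeAverage, norm_mul, norm_inv, Complex.norm_natCast, inv_mul_le_iff₀ hN]
  refine (norm_sum_le_of_le _ fun m _ => hf _).trans_eq ?_
  simp

/-- The Fourier transform of the product is approximated by an average over the nodes. -/
lemma norm_measureHat_mulMeasure_sub_le (hT : ∀ n, 0 < T n)
    (ht : ∀ n m, t n m ∈ Icc (0 : ℝ) 1) {ν : Measure ℝ} [IsFiniteMeasure ν] {A : ℝ} (hA0 : 0 ≤ A)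
    (hA : ∀ᵐ y ∂ν, |y| ≤ A) (ξ : ℝ) (k : ℕ) :
    ‖measureHat (mulMeasure (limitMeasure T t) ν) ξ -
      nodeAverage T t k (smoothedHat ν ξ k k)‖ ≤
      2 * Real.pi * A * (2 * scale k * |ξ|) * ν.real univ := by
  have hcont := continuous_measureHat ν
  have h1 : nodeAverage T t k (smoothedHat ν ξ k k) =
      ∫ θ in (0 : ℝ)..1, measureHat ν (position T t k ⌊θ * nodes T k⌋₊ * ξ) := by
    rw [integral_floor_mul (fun m => measureHat ν (position T t k m * ξ)) (nodes_pos hT k),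
      nodeAverage]
    simp_rw [smoothedHat_of_le le_rfl]
  have hint : ∀ g : ℝ → ℝ, Measurable g →
      IntervalIntegrable (fun θ => measureHat ν (g θ)) volume 0 1 := fun g hg => by
    rw [intervalIntegrable_iff_integrableOn_Ioc_of_le zero_le_one]
    exact Measure.integrableOn_of_bounded (M := ν.real univ) (by simp)
      (hcont.measurable.comp hg).aestronglyMeasurable
      (Eventually.of_forall fun θ => norm_measureHat_le _ _)
  rw [measureHat_mulMeasure, integral_limitMeasure (by fun_prop), h1,
    ← intervalIntegral.integral_sub (hint _ (measurable_limitPoint.mul_const _)) (hint _ ?_)]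
  · have := intervalIntegral.norm_integral_le_of_norm_le_const (a := 0) (b := 1)
      (C := 2 * Real.pi * A * (2 * scale k * |ξ|) * ν.real univ)
      (f := fun θ => measureHat ν (limitPoint T t θ * ξ) -
        measureHat ν (position T t k ⌊θ * nodes T k⌋₊ * ξ)) fun θ _ => by
        refine (norm_measureHat_sub_le ν hA _ _).trans ?_
        have h2 := position_floor_le_limitPoint hT ht θ k
        have h3 := limitPoint_le hT ht θ k
        rw [← sub_mul, abs_mul, abs_of_nonneg (by linarith)]
        have := Real.pi_pos
        gcongr
        linarith
    simpa using this
  · exact ((measurable_from_nat (f := position T t k)).comp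
      (Nat.measurable_floor.comp (measurable_id.mul_const _))).mul_const _

lemma sum_div_sqrt_nodes_le (hT4 : ∀ n, 4 ≤ T n) {n k : ℕ} (hn : 1 ≤ n) (hnk : n ≤ k) :
    ∑ j ∈ Finset.Ico n k, ((j : ℝ) + 1) / Real.sqrt (nodes T (j + 1)) ≤
      4 * (((n : ℝ) + 1) / Real.sqrt (nodes T (n + 1))) := by
  have hT : ∀ n, 0 < T n := fun n => by linarith [hT4 n]
  set a : ℕ → ℝ := fun j => ((j : ℝ) + 1) / Real.sqrt (nodes T (j + 1))
  have hpos : ∀ j, (0 : ℝ) < nodes T j := fun j => by exact_mod_cast nodes_pos hT j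
  have ha : ∀ j, 0 ≤ a j := fun j => by positivity
  -- The terms decrease by a factor of at least `3 / 4`, since the number of nodes quadruples.
  have hstep : ∀ j, 1 ≤ j → a (j + 1) ≤ 3 / 4 * a j := by
    intro j hj
    have h1 := Real.sqrt_pos.2 (hpos (j + 1))
    have h2 := Real.sqrt_pos.2 (hpos (j + 1 + 1))
    have h3 : 2 * Real.sqrt (nodes T (j + 1)) ≤ Real.sqrt (nodes T (j + 1 + 1)) := by
      refine Real.le_sqrt_of_sq_le ?_
      rw [mul_pow, Real.sq_sqrt (hpos _).le, nodes_succ (j + 1), Nat.cast_mul]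
      have : (4 : ℝ) ≤ T (j + 1) := by exact_mod_cast hT4 (j + 1)
      nlinarith [hpos (j + 1)]
    have hj' : (1 : ℝ) ≤ j := by exact_mod_cast hj
    change ((j + 1 : ℕ) + 1 : ℝ) / _ ≤ 3 / 4 * (((j : ℝ) + 1) / _)
    rw [← mul_div_assoc, div_le_div_iff₀ h2 h1]
    push_cast
    nlinarith
  have key : ∑ j ∈ Finset.Ico n k, a j + 4 * a k ≤ 4 * a n := by
    induction k, hnk using Nat.le_induction with
    | base => simp
    | succ k hk ih =>
      rw [Finset.sum_Ico_succ_top hk]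
      linarith [hstep k (hn.trans hk)]
  linarith [ha k]

/-- The telescoping sum of the differences of averages over consecutive generations. -/
lemma norm_nodeAverage_sub_le (hT4 : ∀ n, 4 ≤ T n) {ν : Measure ℝ} {ξ B : ℝ} (hB : 0 ≤ B)
    {n k : ℕ} (hn : 1 ≤ n) (hnk : n ≤ k)
    (h : ∀ j, n ≤ j → j < k → ‖nodeAverage T t (j + 1) (smoothedHat ν ξ k (j + 1)) -
      nodeAverage T t j (smoothedHat ν ξ k j)‖ ≤ B * (((j : ℝ) + 1) / Real.sqrt (nodes T (j + 1)))) :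
    ‖nodeAverage T t k (smoothedHat ν ξ k k) - nodeAverage T t n (smoothedHat ν ξ k n)‖ ≤
      B * (4 * (((n : ℝ) + 1) / Real.sqrt (nodes T (n + 1)))) := by
  rw [← Finset.sum_Ico_sub (fun j => nodeAverage T t j (smoothedHat ν ξ k j)) hnk]
  refine (norm_sum_le_of_le _ (fun j hj => h j (Finset.mem_Ico.1 hj).1
    (Finset.mem_Ico.1 hj).2)).trans ?_
  rw [← Finset.mul_sum]
  exact mul_le_mul_of_nonneg_left (sum_div_sqrt_nodes_le hT4 hn hnk) hB

end Tree

/-- For large `n`, the lengths `scale (n + K)` and `scale n` agree up to a small power, and `n` is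
smaller than a small power of `1 / scale n`. -/
lemma eventually_scale_exponents {ε : ℝ} (hε : 0 < ε) (hε2 : ε ≤ 1 / 2) (K : ℕ) :
    ∀ᶠ n : ℕ in atTop, ((n : ℝ) + K) ^ 2 ≤ (1 + ε / 2) * ((n : ℝ) + 1) ^ 2 ∧
      (n : ℝ) + 1 ≤ 2 ^ (ε * ((n : ℝ) + 1) ^ 2) := by
  filter_upwards [eventually_ge_atTop ⌈5 * (K + 1) / ε⌉₊] with n hn
  have h1 : 5 * (K + 1) / ε ≤ n := (Nat.le_ceil _).trans (by exact_mod_cast hn)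
  rw [div_le_iff₀ hε] at h1
  have hK : (0 : ℝ) ≤ K := Nat.cast_nonneg _
  have hn0 : (0 : ℝ) ≤ n := Nat.cast_nonneg _
  constructor
  · have h2 : (n : ℝ) + K ≤ (1 + ε / 5) * (n + 1) := by nlinarith
    calc ((n : ℝ) + K) ^ 2 ≤ ((1 + ε / 5) * (n + 1)) ^ 2 := by gcongr
      _ = (1 + ε / 5) ^ 2 * ((n : ℝ) + 1) ^ 2 := by ring
      _ ≤ _ := by
        gcongr
        nlinarith
  · have h2 : ((n + 1 : ℕ) : ℝ) ≤ ε * ((n : ℝ) + 1) ^ 2 := by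
      push_cast
      nlinarith
    have h3 : ((n + 1 : ℕ) : ℝ) ≤ (2 : ℝ) ^ ((n + 1 : ℕ) : ℝ) := by
      rw [Real.rpow_natCast]
      exact_mod_cast Nat.lt_two_pow_self.le
    push_cast at h2 h3
    exact h3.trans (Real.rpow_le_rpow_of_exponent_le (by norm_num) h2)

lemma frequencyBound_mono : Monotone frequencyBound := fun m n h => by
  unfold frequencyBound
  exact Nat.pow_le_pow_right (by norm_num) (by gcongr)

lemma rpow_le_frequencyBound {L : ℝ} {n : ℕ} (h : 2 * L ≤ 16 * ((n : ℝ) + 1) ^ 2) :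
    (2 : ℝ) ^ (2 * L) ≤ frequencyBound n := by
  rw [cast_frequencyBound, ← Real.rpow_natCast]
  refine Real.rpow_le_rpow_of_exponent_le (by norm_num) ?_
  push_cast
  exact h

lemma scale_mul_le (k : ℕ) : scale k * k ≤ 1 := by
  have h1 : k ≤ 2 ^ ((k + 1) ^ 2) :=
    Nat.lt_two_pow_self.le.trans (Nat.pow_le_pow_right (by norm_num) (by nlinarith))
  have h2 : (k : ℝ) ≤ 2 ^ ((k + 1) ^ 2) := by exact_mod_cast h1
  rw [scale, one_div, inv_pow, inv_mul_le_iff₀ (by positivity), mul_one]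
  exact h2

/-- The Fourier decay at the frequency `√k = 2 ^ L`. Generation `n` is the last one whose intervals
have length at least `2 ^ (-(1 - ε) L)`: up to this generation the smoothing makes everything small,
and from there on, the square root cancellation over the nodes is effective. -/
lemma norm_measureHat_mulMeasure_le {T : ℕ → ℕ} {t : ℕ → ℕ → ℝ} {α : ℝ} (hα0 : 0 ≤ α) (hα1 : α ≤ 1)
    (hT4 : ∀ n, 4 ≤ T n) (hTα : ∀ n, ((2 : ℝ) ^ (2 * n + 3)) ^ α ≤ T n)
    (ht : ∀ n m, t n m ∈ Icc (0 : ℝ) 1) {ν : Measure ℝ} [IsFiniteMeasure ν] {A δ C s : ℝ}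
    (hA0 : 0 ≤ A) (hA : ∀ᵐ y ∂ν, |y| ≤ A) (hδ0 : 0 < δ) (hδ : ∀ᵐ y ∂ν, δ ≤ |y|)
    (hC : 0 ≤ C) (hs : 0 ≤ s) {i : ℕ}
    (hctrl : ∀ n k : ℕ, i ≤ n → n < k → k ≤ frequencyBound n →
        ‖nodeAverage T t (n + 1) (smoothedHat ν (Real.sqrt k) k (n + 1)) -
          nodeAverage T t n (smoothedHat ν (Real.sqrt k) k n)‖ ≤
        C * (1 + Real.sqrt k) ^ (-(s / 2)) * (50 * ((n + 1) / Real.sqrt (nodes T (n + 1)))))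
    {ε : ℝ} (hε0 : 0 < ε) (hε2 : ε ≤ 1 / 2) {K n k : ℕ} {L : ℝ} (hK : 2 ≤ ε * K)
    (hn1 : 1 ≤ n) (hin : i ≤ n) (hKn : K ≤ n)
    (hnK : ((n : ℝ) + K) ^ 2 ≤ (1 + ε / 2) * ((n : ℝ) + 1) ^ 2)
    (hnε : (n : ℝ) + 1 ≤ 2 ^ (ε * ((n : ℝ) + 1) ^ 2)) (hL : Real.sqrt k = 2 ^ L)
    (hL1 : ((n : ℝ) + 1) ^ 2 ≤ (1 - ε) * L) (hL2 : (1 - ε) * L < ((n : ℝ) + 2) ^ 2) :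
    ‖measureHat (mulMeasure (limitMeasure T t) ν) (Real.sqrt k)‖ ≤
      (2 * Real.pi * A * 2 * ν.real univ + (1 / δ) ^ K * ν.real univ) * 2 ^ (-L) +
        400 * C * 2 ^ ((-(s / 2) - (1 - ε) * α / 2 + ε) * L) := by
  have hT : ∀ n, 0 < T n := fun n => by linarith [hT4 n]
  have hL0 : 0 ≤ L := by
    by_contra! h
    nlinarith [sq_nonneg ((n : ℝ) + 1)]
  have hn0 : (1 : ℝ) ≤ n := by exact_mod_cast hn1
  have hk2 : (k : ℝ) = 2 ^ (2 * L) := by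
    rw [← Real.sq_sqrt (Nat.cast_nonneg k), hL, ← Real.rpow_mul_natCast (by norm_num)]
    congr 1
    push_cast
    ring
  have hξ0 : 0 < Real.sqrt k := by rw [hL]; positivity
  have hLn : ((n : ℝ) + 1) ^ 2 ≤ L := by nlinarith
  have hnKk : n + K ≤ k := by
    have h1 : ((n + K : ℕ) : ℝ) ≤ ((2 * n : ℕ) : ℝ) := by exact_mod_cast by omega
    have h2 : ((2 * n : ℕ) : ℝ) ≤ (2 : ℝ) ^ ((2 * n : ℕ) : ℝ) := by
      rw [Real.rpow_natCast]
      exact_mod_cast Nat.lt_two_pow_self.le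
    have h3 : ((2 * n : ℕ) : ℝ) ≤ 2 * L := by push_cast; nlinarith
    have h4 : ((n + K : ℕ) : ℝ) ≤ k := by
      rw [hk2]
      exact h1.trans (h2.trans (Real.rpow_le_rpow_of_exponent_le (by norm_num) h3))
    exact_mod_cast h4
  have hkF : k ≤ frequencyBound n := by
    have h1 : 2 * L ≤ 16 * ((n : ℝ) + 1) ^ 2 := by nlinarith
    have := rpow_le_frequencyBound h1
    rw [← hk2] at this
    exact_mod_cast this
  -- The approximation of the limit measure by generation `k`.
  have hfirst : ‖measureHat (mulMeasure (limitMeasure T t) ν) (Real.sqrt k) -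
      nodeAverage T t k (smoothedHat ν (Real.sqrt k) k k)‖ ≤
      2 * Real.pi * A * 2 * ν.real univ * 2 ^ (-L) := by
    refine (norm_measureHat_mulMeasure_sub_le hT ht hA0 hA _ k).trans ?_
    rw [abs_of_pos hξ0]
    have h1 : scale k * Real.sqrt k ≤ 2 ^ (-L) := by
      rw [Real.rpow_neg (by norm_num), ← hL, ← one_div, le_div_iff₀ hξ0, mul_assoc,
        Real.mul_self_sqrt (Nat.cast_nonneg k)]
      exact scale_mul_le k
    have := Real.pi_pos
    calc _ = 2 * Real.pi * A * 2 * ν.real univ * (scale k * Real.sqrt k) := by ring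
      _ ≤ _ := by gcongr
  -- The generations up to `n`.
  have hsecond : ‖nodeAverage T t n (smoothedHat ν (Real.sqrt k) k n)‖ ≤
      (1 / δ) ^ K * ν.real univ * 2 ^ (-L) := by
    refine norm_nodeAverage_le hT fun x => ?_
    refine (norm_smoothedHat_le_pow (r := 2 ^ (-(ε / 2 * L))) hδ0 hδ hξ0 hnKk (fun j hj => ?_)
      x).trans ?_
    · have h1 : (j : ℝ) + 1 ≤ n + K := by exact_mod_cast hj
      rw [scale_eq_rpow, hL, ← Real.rpow_add (by norm_num), one_div, ← Real.rpow_neg (by norm_num)]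
      refine Real.rpow_le_rpow_of_exponent_le (by norm_num) ?_
      have h2 : ((j : ℝ) + 1) ^ 2 ≤ (n + K) ^ 2 := by gcongr
      have h3 : (1 + ε / 2) * ((n : ℝ) + 1) ^ 2 ≤ (1 + ε / 2) * ((1 - ε) * L) := by gcongr
      nlinarith [mul_nonneg hε0.le hL0, mul_nonneg (sq_nonneg ε) hL0]
    · rw [div_eq_mul_one_div, mul_pow, ← Real.rpow_mul_natCast (by norm_num)]
      have h1 : (2 : ℝ) ^ (-(ε / 2 * L) * K) ≤ 2 ^ (-L) :=
        Real.rpow_le_rpow_of_exponent_le (by norm_num) (by nlinarith)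
      calc _ = (1 / δ) ^ K * ν.real univ * 2 ^ (-(ε / 2 * L) * K) := by ring
        _ ≤ _ := by gcongr
  -- The generations from `n` to `k`.
  have hthird := norm_nodeAverage_sub_le (T := T) (t := t) (ν := ν) (ξ := Real.sqrt k)
    (B := C * (1 + Real.sqrt k) ^ (-(s / 2)) * 50) hT4 (by positivity) hn1
    ((Nat.le_add_right n K).trans hnKk) (fun j hj1 hj2 => by
      rw [mul_assoc]
      exact hctrl j k (hin.trans hj1) hj2 (hkF.trans (frequencyBound_mono hj1)))
  have hN : 1 / Real.sqrt (nodes T (n + 1)) ≤ 2 * 2 ^ (-((1 - ε) * α / 2 * L)) := by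
    have hb : (2 : ℝ) ^ ((1 - ε) * α / 2 * L - 1) ≤ Real.sqrt (nodes T (n + 1)) := by
      refine Real.le_sqrt_of_sq_le ?_
      refine le_trans ?_ (rpow_le_nodes hTα (n + 1))
      rw [← Real.rpow_mul_natCast (by norm_num)]
      refine Real.rpow_le_rpow_of_exponent_le (by norm_num) ?_
      push_cast
      have : α * ((1 - ε) * L) ≤ α * ((n : ℝ) + 2) ^ 2 := by gcongr
      nlinarith
    calc _ ≤ 1 / (2 : ℝ) ^ ((1 - ε) * α / 2 * L - 1) := by gcongr
      _ = _ := by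
        rw [one_div, ← Real.rpow_neg (by norm_num), neg_sub, Real.rpow_sub (by norm_num),
          Real.rpow_neg (by norm_num), Real.rpow_one, div_eq_mul_inv]
  have hthird' : C * (1 + Real.sqrt k) ^ (-(s / 2)) * 50 *
      (4 * (((n : ℝ) + 1) / Real.sqrt (nodes T (n + 1)))) ≤
      400 * C * 2 ^ ((-(s / 2) - (1 - ε) * α / 2 + ε) * L) := by
    have h1 : (1 + Real.sqrt k) ^ (-(s / 2)) ≤ 2 ^ (-(s / 2) * L) := by
      rw [mul_comm, Real.rpow_mul (by norm_num), ← hL]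
      exact Real.rpow_le_rpow_of_nonpos hξ0 (by linarith) (by linarith)
    have h2 : (n : ℝ) + 1 ≤ 2 ^ (ε * L) :=
      hnε.trans (Real.rpow_le_rpow_of_exponent_le (by norm_num) (by gcongr))
    calc _ = C * (1 + Real.sqrt k) ^ (-(s / 2)) * 50 *
          (4 * (((n : ℝ) + 1) * (1 / Real.sqrt (nodes T (n + 1))))) := by ring
      _ ≤ C * 2 ^ (-(s / 2) * L) * 50 *
          (4 * (2 ^ (ε * L) * (2 * 2 ^ (-((1 - ε) * α / 2 * L))))) := by gcongr
      _ = 400 * C * (2 ^ (-(s / 2) * L) * 2 ^ (ε * L) * 2 ^ (-((1 - ε) * α / 2 * L))) := by ring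
      _ = _ := by
        rw [← Real.rpow_add (by norm_num), ← Real.rpow_add (by norm_num)]
        congr 2
        ring
  have hsum : ∀ a b c : ℂ, ‖a‖ ≤ ‖a - b‖ + (‖b - c‖ + ‖c‖) := fun a b c => by
    calc ‖a‖ = ‖(a - b) + ((b - c) + c)‖ := by congr 1; ring
      _ ≤ _ := (norm_add_le _ _).trans (add_le_add_right (norm_add_le _ _) _)
  refine (hsum _ (nodeAverage T t k (smoothedHat ν (Real.sqrt k) k k))
    (nodeAverage T t n (smoothedHat ν (Real.sqrt k) k n))).trans ?_
  linarith

lemma exists_sq_le_lt {x : ℝ} {n₀ : ℕ} (hx : ((n₀ : ℝ) + 1) ^ 2 ≤ x) :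
    ∃ n ≥ n₀, ((n : ℝ) + 1) ^ 2 ≤ x ∧ x < ((n : ℝ) + 2) ^ 2 := by
  have hx0 : 0 ≤ x := (sq_nonneg _).trans hx
  have h1 : n₀ + 1 ≤ ⌊Real.sqrt x⌋₊ := by
    refine Nat.le_floor ?_
    push_cast
    exact Real.le_sqrt_of_sq_le hx
  obtain ⟨n, hn⟩ : ∃ n, ⌊Real.sqrt x⌋₊ = n + 1 := ⟨⌊Real.sqrt x⌋₊ - 1, by omega⟩
  have h2 : ((n + 1 : ℕ) : ℝ) ≤ Real.sqrt x := hn ▸ Nat.floor_le (Real.sqrt_nonneg x)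
  have h3 : Real.sqrt x < ((n + 1 : ℕ) : ℝ) + 1 := hn ▸ Nat.lt_floor_add_one _
  push_cast at h2 h3
  have h4 := Real.sq_sqrt hx0
  have h5 := Real.sqrt_nonneg x
  refine ⟨n, by omega, ?_, ?_⟩
  · rw [← h4]
    gcongr
  · rw [← h4]
    gcongr
    linarith

lemma ae_abs_le_mulMeasure {μ ν : Measure ℝ} [IsFiniteMeasure μ] [IsFiniteMeasure ν] {A B : ℝ}
    (hμ : ∀ᵐ x ∂μ, |x| ≤ A) (hν : ∀ᵐ y ∂ν, |y| ≤ B) :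
    ∀ᵐ z ∂(mulMeasure μ ν), |z| ≤ A * B := by
  rw [mulMeasure, Measure.mconv, ae_map_iff (by fun_prop)
    (measurableSet_le (by fun_prop) (by fun_prop))]
  have h1 := Measure.quasiMeasurePreserving_fst (μ := μ) (ν := ν) |>.ae hμ
  have h2 := Measure.quasiMeasurePreserving_snd (μ := μ) (ν := ν) |>.ae hν
  filter_upwards [h1, h2] with p hp1 hp2
  rw [abs_mul]
  exact mul_le_mul hp1 hp2 (abs_nonneg _) ((abs_nonneg _).trans hp1)

lemma ae_abs_limitMeasure_le {T : ℕ → ℕ} {t : ℕ → ℕ → ℝ} (hT : ∀ n, 0 < T n)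
    (ht : ∀ n m, t n m ∈ Icc (0 : ℝ) 1) : ∀ᵐ x ∂(limitMeasure T t), |x| ≤ 2 := by
  rw [limitMeasure, ae_map_iff measurable_limitPoint.aemeasurable
    (measurableSet_le (by fun_prop) (by fun_prop))]
  refine Eventually.of_forall fun θ => ?_
  have := limitPoint_mem_Icc hT ht θ
  rw [abs_of_nonneg (by linarith [this.1])]
  exact this.2

/-- The orders of decay of the limit measure and of `ν` add up, for the measures `ν` which are
controlled by the choice of the tree. -/
theorem hasFourierDecay_mulMeasure {T : ℕ → ℕ} {t : ℕ → ℕ → ℝ} {α : ℝ} (hα0 : 0 ≤ α) (hα1 : α ≤ 1)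
    (hT4 : ∀ n, 4 ≤ T n) (hTα : ∀ n, ((2 : ℝ) ^ (2 * n + 3)) ^ α ≤ T n)
    (ht : ∀ n m, t n m ∈ Icc (0 : ℝ) 1) {ν : Measure ℝ} [IsFiniteMeasure ν] {A δ C s : ℝ}
    (hA0 : 0 ≤ A) (hA : ∀ᵐ y ∂ν, |y| ≤ A) (hδ0 : 0 < δ) (hδ : ∀ᵐ y ∂ν, δ ≤ |y|)
    (hC : 0 ≤ C) (hs : 0 ≤ s) {i : ℕ}
    (hctrl : ∀ n k : ℕ, i ≤ n → n < k → k ≤ frequencyBound n →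
        ‖nodeAverage T t (n + 1) (smoothedHat ν (Real.sqrt k) k (n + 1)) -
          nodeAverage T t n (smoothedHat ν (Real.sqrt k) k n)‖ ≤
        C * (1 + Real.sqrt k) ^ (-(s / 2)) * (50 * ((n + 1) / Real.sqrt (nodes T (n + 1)))))
    {τ : ℝ} (hτ0 : 0 ≤ τ) (hτ2 : τ ≤ 2) (hτ : τ < α + s) :
    HasFourierDecay (mulMeasure (limitMeasure T t) ν) τ := by
  have hT : ∀ n, 0 < T n := fun n => by linarith [hT4 n]
  set ε := min (1 / 2) ((α + s - τ) / 3)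
  have hε0 : 0 < ε := lt_min (by norm_num) (by linarith)
  have hε2 : ε ≤ 1 / 2 := min_le_left _ _
  have hε3 : ε ≤ (α + s - τ) / 3 := min_le_right _ _
  set K := ⌈2 / ε⌉₊
  have hK : 2 ≤ ε * K := by
    have := Nat.le_ceil (2 / ε)
    rw [div_le_iff₀ hε0] at this
    linarith
  obtain ⟨n₀, hn₀⟩ := eventually_atTop.1 ((eventually_scale_exponents hε0 hε2 K).and
    ((eventually_ge_atTop 1).and ((eventually_ge_atTop i).and (eventually_ge_atTop K))))
  set D := (2 * Real.pi * A * 2 * ν.real univ + (1 / δ) ^ K * ν.real univ) + 400 * C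
  have hD : 0 ≤ D := by positivity
  have hev : ∀ᶠ k : ℕ in atTop, ‖measureHat (mulMeasure (limitMeasure T t) ν) (Real.sqrt k)‖ *
      (1 + Real.sqrt k) ^ (τ / 2) ≤ D * 2 ^ (τ / 2) := by
    have hlog : Tendsto (fun k : ℕ => Real.logb 2 (Real.sqrt k)) atTop atTop :=
      (Real.tendsto_logb_atTop (by norm_num)).comp
        (Real.tendsto_sqrt_atTop.comp tendsto_natCast_atTop_atTop)
    filter_upwards [hlog.eventually_ge_atTop (((n₀ : ℝ) + 1) ^ 2 / (1 - ε)),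
      eventually_ge_atTop 1] with k hk hk1
    set L := Real.logb 2 (Real.sqrt k)
    have hk1' : (1 : ℝ) ≤ Real.sqrt k := Real.one_le_sqrt.2 (by exact_mod_cast hk1)
    have hL : Real.sqrt k = 2 ^ L :=
      (Real.rpow_logb (by norm_num) (by norm_num) (by linarith)).symm
    rw [div_le_iff₀ (by linarith), mul_comm] at hk
    obtain ⟨n, hn, hL1, hL2⟩ := exists_sq_le_lt hk
    obtain ⟨⟨h1, h2⟩, h3, h4, h5⟩ := hn₀ n hn
    have hL0 : 0 ≤ L := Real.logb_nonneg (by norm_num) hk1'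
    have hmain := norm_measureHat_mulMeasure_le hα0 hα1 hT4 hTα ht hA0 hA hδ0 hδ hC hs hctrl hε0
      hε2 hK h3 h4 h5 h1 h2 hL hL1 hL2
    have h6 : (2 : ℝ) ^ (-L) ≤ 2 ^ (-(τ / 2) * L) :=
      Real.rpow_le_rpow_of_exponent_le (by norm_num) (by nlinarith)
    have h7 : (2 : ℝ) ^ ((-(s / 2) - (1 - ε) * α / 2 + ε) * L) ≤ 2 ^ (-(τ / 2) * L) := by
      refine Real.rpow_le_rpow_of_exponent_le (by norm_num) ?_
      have : ε * α ≤ ε := by nlinarith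
      gcongr
      nlinarith
    have h8 : ‖measureHat (mulMeasure (limitMeasure T t) ν) (Real.sqrt k)‖ ≤
        D * 2 ^ (-(τ / 2) * L) := by
      refine hmain.trans ?_
      rw [add_mul _ (400 * C)]
      gcongr
    have h9 : (1 + Real.sqrt k) ^ (τ / 2) ≤ 2 ^ (τ / 2) * 2 ^ (τ / 2 * L) := by
      rw [mul_comm (τ / 2) L, Real.rpow_mul (by norm_num), ← hL,
        ← Real.mul_rpow (by norm_num) (by linarith)]
      gcongr
      linarith
    calc _ ≤ D * 2 ^ (-(τ / 2) * L) * (2 ^ (τ / 2) * 2 ^ (τ / 2 * L)) := by gcongr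
      _ = D * 2 ^ (τ / 2) * (2 ^ (-(τ / 2) * L) * 2 ^ (τ / 2 * L)) := by ring
      _ = _ := by
        rw [← Real.rpow_add (by norm_num)]
        simp
  obtain ⟨D', hD'⟩ := Filter.IsBoundedUnder.bddAbove_range ⟨_, eventually_map.2 hev⟩
  refine hasFourierDecay_of_sqrt _
    (ae_abs_le_mulMeasure (ae_abs_limitMeasure_le hT ht) hA) hτ0 hτ2 (C := D') fun k => ?_
  have h1 := hD' ⟨k, rfl⟩
  dsimp only at h1
  rw [Real.rpow_neg (by positivity), ← div_eq_mul_inv, le_div_iff₀ (by positivity)]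
  exact h1

/-! ### Upper bounds for dimensions from coverings -/

section Covering

variable {R : Set ℝ} {N : ℕ → ℕ} {a : ∀ n, Fin (N n) → ℝ} {w : ℕ → ℝ}

lemma dimH_le_of_cover (hw : ∀ n, 0 < w n) (hw0 : Tendsto w atTop (𝓝 0))
    (hR : ∀ n, R ⊆ ⋃ m, Icc (a n m) (a n m + w n)) {d : ℝ≥0}
    (h : Tendsto (fun n => N n * w n ^ (d : ℝ)) atTop (𝓝 0)) : dimH R ≤ d := by
  refine dimH_le_of_hausdorffMeasure_ne_top (ne_top_of_le_ne_top ENNReal.zero_ne_top ?_)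
  have hdiam : ∀ n m, Metric.ediam (Icc (a n m) (a n m + w n)) = ENNReal.ofReal (w n) := fun n m => by
    rw [Real.ediam_Icc, add_sub_cancel_left]
  have h1 := Measure.hausdorffMeasure_le_liminf_sum (d : ℝ) R (l := atTop)
    (fun n => ENNReal.ofReal (w n)) (by simpa using ENNReal.tendsto_ofReal hw0)
    (fun n m => Icc (a n m) (a n m + w n)) (Eventually.of_forall fun n m => (hdiam n m).le)
    (Eventually.of_forall hR)
  refine h1.trans ?_
  have h2 : Tendsto (fun n => ∑ m : Fin (N n), Metric.ediam (Icc (a n m) (a n m + w n)) ^ (d : ℝ))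
      atTop (𝓝 0) := by
    have h3 := ENNReal.tendsto_ofReal h
    rw [ENNReal.ofReal_zero] at h3
    refine h3.congr fun n => ?_
    simp_rw [hdiam]
    rw [Finset.sum_const, nsmul_eq_mul, Finset.card_univ, Fintype.card_fin,
      ENNReal.ofReal_mul (Nat.cast_nonneg _), ENNReal.ofReal_natCast,
      ENNReal.ofReal_rpow_of_pos (hw n)]
  exact h2.liminf_eq.le

/-- If the lower local dimension of `μ` exceeds `d` almost everywhere, then `μ` cannot live on a set
with efficient coverings: on a set of positive measure, `μ (ball x r) ≤ r ^ d` for all small `r`. -/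
lemma not_ae_le_lowerLocalDim_of_cover (hw : ∀ n, 0 < w n) (hw0 : Tendsto w atTop (𝓝 0))
    (hR : ∀ n, R ⊆ ⋃ m, Icc (a n m) (a n m + w n)) {d s : ℝ} (hds : d < s)
    (h : Tendsto (fun n => N n * w n ^ d) atTop (𝓝 0)) {μ : Measure ℝ} [IsFiniteMeasure μ]
    (hμ0 : μ ≠ 0) (hμR : ∀ᵐ x ∂μ, x ∈ R) :
    ¬ ∀ᵐ x ∂μ, (s : EReal) ≤ lowerLocalDim μ x := by
  intro hs
  set E : ℕ → Set ℝ := fun k =>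
    {x | x ∈ R ∧ ∀ r : ℝ, 0 < r → r < 1 / (k + 1) → μ (Metric.ball x r) ≤ ENNReal.ofReal (r ^ d)}
  have hE : ∀ᵐ x ∂μ, x ∈ ⋃ k, E k := by
    filter_upwards [hs, hμR] with x hx hxR
    have h1 : ∀ᶠ r in 𝓝[>] (0 : ℝ), ((d : ℝ) : EReal) <
        ((Real.log (μ.real (Metric.ball x r)) / Real.log r : ℝ) : EReal) :=
      eventually_lt_of_lt_liminf ((EReal.coe_lt_coe hds).trans_le hx)
    obtain ⟨u, hu, hu'⟩ := mem_nhdsGT_iff_exists_Ioo_subset.1 h1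
    obtain ⟨k, hk⟩ := exists_nat_one_div_lt (lt_min hu (zero_lt_one' ℝ))
    refine mem_iUnion.2 ⟨k, hxR, fun r hr0 hr => ?_⟩
    have hr1 : r < 1 := hr.trans (hk.trans_le (min_le_right _ _))
    have h2 : d < Real.log (μ.real (Metric.ball x r)) / Real.log r :=
      EReal.coe_lt_coe_iff.1 (hu' ⟨hr0, hr.trans (hk.trans_le (min_le_left _ _))⟩)
    rw [lt_div_iff_of_neg (Real.log_neg hr0 hr1)] at h2
    rw [← ofReal_measureReal]
    refine ENNReal.ofReal_le_ofReal ?_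
    rcases eq_or_lt_of_le (measureReal_nonneg (μ := μ) (s := Metric.ball x r)) with h0 | h0
    · rw [← h0]
      positivity
    · rw [← Real.log_rpow hr0] at h2
      exact ((Real.log_lt_log_iff h0 (by positivity)).1 h2).le
  obtain ⟨k, hk⟩ : ∃ k, μ (E k) ≠ 0 := by
    by_contra! h0
    have h1 : μ (⋃ k, E k) = 0 := measure_iUnion_null h0
    have h2 : ∀ᵐ _ ∂μ, False := by
      filter_upwards [hE, measure_eq_zero_iff_ae_notMem.1 h1] with x hx hx'
      exact hx' hx
    exact hμ0 (ae_eq_bot.1 (eventually_false_iff_eq_bot.1 h2))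
  have hbound : ∀ᶠ n in atTop, μ (E k) ≤ ENNReal.ofReal (2 ^ d * (N n * w n ^ d)) := by
    have hev : ∀ᶠ n in atTop, w n < 1 / (k + 1) / 2 := hw0.eventually_lt_const (by positivity)
    filter_upwards [hev] with n hn
    have hsub : E k ⊆ ⋃ m, (E k ∩ Icc (a n m) (a n m + w n)) := by
      rw [← inter_iUnion]
      exact subset_inter le_rfl fun x hx => hR n hx.1
    have hpiece : ∀ m, μ (E k ∩ Icc (a n m) (a n m + w n)) ≤ ENNReal.ofReal ((2 * w n) ^ d) := by
      intro m
      rcases (E k ∩ Icc (a n m) (a n m + w n)).eq_empty_or_nonempty with h0 | ⟨x, hxE, hx⟩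
      · simp [h0]
      · refine le_trans (measure_mono ?_) (hxE.2 (2 * w n) (by linarith [hw n]) (by linarith))
        rintro y ⟨-, hy⟩
        rw [Metric.mem_ball, Real.dist_eq, abs_lt]
        constructor <;> linarith [hx.1, hx.2, hy.1, hy.2, hw n]
    calc μ (E k) ≤ ∑ m, μ (E k ∩ Icc (a n m) (a n m + w n)) :=
          (measure_mono hsub).trans (measure_iUnion_fintype_le _ _)
      _ ≤ ∑ _m : Fin (N n), ENNReal.ofReal ((2 * w n) ^ d) := Finset.sum_le_sum fun m _ => hpiece m
      _ = _ := by
        rw [Finset.sum_const, nsmul_eq_mul, Finset.card_univ, Fintype.card_fin,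
          ← ENNReal.ofReal_natCast, ← ENNReal.ofReal_mul (Nat.cast_nonneg _),
          Real.mul_rpow (by norm_num) (hw n).le]
        congr 1
        ring
  have hlim : Tendsto (fun n => ENNReal.ofReal (2 ^ d * (N n * w n ^ d))) atTop (𝓝 0) := by
    simpa using ENNReal.tendsto_ofReal (h.const_mul (2 ^ d))
  exact hk (le_antisymm (ge_of_tendsto hlim hbound) zero_le)

end Covering

/-! ### Gaussian energies -/

lemma ofReal_exp_gaussian_eq_integral {r : ℝ} (hr : 0 < r) (z : ℝ) :
    ((Real.exp (-Real.pi * (z / r) ^ 2) : ℝ) : ℂ) =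
      r * ∫ ξ : ℝ, fexp (z * ξ) * (Real.exp (-(Real.pi * r ^ 2) * ξ ^ 2) : ℝ) := by
  have hb : 0 < ((Real.pi * r ^ 2 : ℝ) : ℂ).re := by
    rw [Complex.ofReal_re]
    positivity
  have h := fourierIntegral_gaussian hb ((-2 * Real.pi * z : ℝ) : ℂ)
  have hr' : (r : ℂ) ≠ 0 := by exact_mod_cast hr.ne'
  have hpi : (Real.pi : ℂ) ≠ 0 := by exact_mod_cast Real.pi_ne_zero
  have h1 : ((Real.pi : ℂ) / ((Real.pi * r ^ 2 : ℝ) : ℂ)) ^ (1 / 2 : ℂ) = (r : ℂ)⁻¹ := by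
    have h2 : (Real.pi : ℂ) / ((Real.pi * r ^ 2 : ℝ) : ℂ) = (((r⁻¹) ^ 2 : ℝ) : ℂ) := by
      push_cast
      field_simp
    rw [h2, show (1 / 2 : ℂ) = ((1 / 2 : ℝ) : ℂ) by norm_num,
      ← Complex.ofReal_cpow (by positivity), ← Real.sqrt_eq_rpow, Real.sqrt_sq (by positivity),
      Complex.ofReal_inv]
  rw [h1] at h
  have h3 : ∫ ξ : ℝ, fexp (z * ξ) * (Real.exp (-(Real.pi * r ^ 2) * ξ ^ 2) : ℝ) =
      ∫ x : ℝ, Complex.exp (Complex.I * ((-2 * Real.pi * z : ℝ) : ℂ) * x) *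
        Complex.exp (-((Real.pi * r ^ 2 : ℝ) : ℂ) * x ^ 2) := by
    congr 1
    ext ξ
    rw [fexp, Complex.ofReal_exp]
    congr 2
    · push_cast
      ring
    · push_cast
      ring
  rw [h3, h, ← mul_assoc, mul_inv_cancel₀ hr', one_mul, Complex.ofReal_exp]
  congr 1
  push_cast
  field_simp
  ring

lemma integral_prod_gaussian_eq (σ : Measure ℝ) [IsFiniteMeasure σ] {r : ℝ} (hr : 0 < r) :
    ∫ p : ℝ × ℝ, Real.exp (-Real.pi * ((p.1 - p.2) / r) ^ 2) ∂(σ.prod σ) =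
      r * ∫ ξ : ℝ, ‖measureHat σ ξ‖ ^ 2 * Real.exp (-(Real.pi * r ^ 2) * ξ ^ 2) := by
  have hgauss : Integrable (fun ξ : ℝ => Real.exp (-(Real.pi * r ^ 2) * ξ ^ 2)) :=
    integrable_exp_neg_mul_sq (by positivity)
  have hint : Integrable (Function.uncurry fun (p : ℝ × ℝ) (ξ : ℝ) => fexp ((p.1 - p.2) * ξ) *
      (Real.exp (-(Real.pi * r ^ 2) * ξ ^ 2) : ℝ)) ((σ.prod σ).prod volume) := by
    have h1 : Integrable (fun q : (ℝ × ℝ) × ℝ =>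
        ((Real.exp (-(Real.pi * r ^ 2) * q.2 ^ 2) : ℝ) : ℂ)) ((σ.prod σ).prod volume) :=
      (hgauss.comp_snd (σ.prod σ)).ofReal
    refine h1.bdd_mul (c := 1) (f := fun q : (ℝ × ℝ) × ℝ => fexp ((q.1.1 - q.1.2) * q.2)) ?_ ?_
    · exact Continuous.aestronglyMeasurable (by fun_prop)
    · exact Eventually.of_forall fun q => (norm_fexp _).le
  apply Complex.ofReal_injective
  rw [← integral_complex_ofReal, Complex.ofReal_mul, ← integral_complex_ofReal]
  calc ∫ p : ℝ × ℝ, ((Real.exp (-Real.pi * ((p.1 - p.2) / r) ^ 2) : ℝ) : ℂ) ∂(σ.prod σ)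
      = ∫ p : ℝ × ℝ, (r * ∫ ξ : ℝ, fexp ((p.1 - p.2) * ξ) *
          (Real.exp (-(Real.pi * r ^ 2) * ξ ^ 2) : ℝ)) ∂(σ.prod σ) := by
        congr 1
        ext p
        exact ofReal_exp_gaussian_eq_integral hr _
    _ = r * ∫ ξ : ℝ, (∫ p : ℝ × ℝ, fexp ((p.1 - p.2) * ξ) *
          (Real.exp (-(Real.pi * r ^ 2) * ξ ^ 2) : ℝ) ∂(σ.prod σ)) := by
        rw [integral_const_mul, integral_integral_swap hint]
    _ = _ := by
        congr 2
        ext ξ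
        rw [integral_mul_const]
        have h2 : ∫ p : ℝ × ℝ, fexp ((p.1 - p.2) * ξ) ∂(σ.prod σ) =
            measureHat σ ξ * measureHat σ (-ξ) := by
          rw [measureHat_eq_integral_fexp, measureHat_eq_integral_fexp, ← integral_prod_mul]
          congr 1
          ext p
          rw [← fexp_add]
          congr 1
          ring
        rw [h2, measureHat_neg, Complex.mul_conj, Complex.normSq_eq_norm_sq]
        push_cast
        rfl

/-- A measure with Fourier decay of order `s < 1` has mass of order at most `r ^ s` near the diagonal
of its square. -/
lemma exists_integral_prod_gaussian_le {σ : Measure ℝ} [IsFiniteMeasure σ] {s : ℝ} (hs0 : 0 ≤ s)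
    (hs1 : s < 1) (h : HasFourierDecay σ s) :
    ∃ D : ℝ, ∀ r, 0 < r →
      ∫ p : ℝ × ℝ, Real.exp (-Real.pi * ((p.1 - p.2) / r) ^ 2) ∂(σ.prod σ) ≤ D * r ^ s := by
  obtain ⟨C, hC0, hC⟩ := (hasFourierDecay_iff_exists σ hs0).1 h
  refine ⟨C ^ 2 * (2 * (Real.pi ^ (-(-s + 1) / 2) * (1 / 2) * Real.Gamma ((-s + 1) / 2))),
    fun r hr => ?_⟩
  have hb : 0 < Real.pi * r ^ 2 := by positivity
  have hgauss : Integrable (fun ξ : ℝ => Real.exp (-(Real.pi * r ^ 2) * ξ ^ 2)) :=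
    integrable_exp_neg_mul_sq hb
  have hweight : ∀ ξ : ℝ, (1 + |ξ|) ^ (-s) ≤ 1 := fun ξ =>
    Real.rpow_le_one_of_one_le_of_nonpos (by linarith [abs_nonneg ξ]) (by linarith)
  have hint : Integrable fun ξ : ℝ => (1 + |ξ|) ^ (-s) * Real.exp (-(Real.pi * r ^ 2) * ξ ^ 2) := by
    refine hgauss.bdd_mul (c := 1) ?_ (Eventually.of_forall fun ξ => ?_)
    · refine Continuous.aestronglyMeasurable ?_
      exact Continuous.rpow_const (by fun_prop) fun ξ => Or.inl (by positivity)
    · rw [Real.norm_of_nonneg (by positivity)]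
      exact hweight ξ
  have h1 : ∫ ξ : ℝ, ‖measureHat σ ξ‖ ^ 2 * Real.exp (-(Real.pi * r ^ 2) * ξ ^ 2) ≤
      C ^ 2 * ∫ ξ : ℝ, (1 + |ξ|) ^ (-s) * Real.exp (-(Real.pi * r ^ 2) * ξ ^ 2) := by
    rw [← integral_const_mul]
    refine integral_mono_of_nonneg (Eventually.of_forall fun ξ => by positivity)
      (hint.const_mul _) (Eventually.of_forall fun ξ => ?_)
    dsimp only
    rw [← mul_assoc]
    gcongr
    calc ‖measureHat σ ξ‖ ^ 2 ≤ (C * (1 + |ξ|) ^ (-(s / 2))) ^ 2 := by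
          gcongr
          exact hC ξ
      _ = _ := by
          rw [mul_pow, ← Real.rpow_mul_natCast (by positivity)]
          congr 2
          push_cast
          ring
  have h2 : ∫ ξ : ℝ, (1 + |ξ|) ^ (-s) * Real.exp (-(Real.pi * r ^ 2) * ξ ^ 2) ≤
      2 * ((Real.pi * r ^ 2) ^ (-(-s + 1) / 2) * (1 / 2) * Real.Gamma ((-s + 1) / 2)) := by
    have h3 := integral_comp_abs (f := fun x => (1 + x) ^ (-s) * Real.exp (-(Real.pi * r ^ 2) * x ^ 2))
    simp only [sq_abs] at h3
    rw [h3]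
    gcongr
    rw [← integral_rpow_mul_exp_neg_mul_rpow (p := 2) (q := -s) (by norm_num) (by linarith) hb]
    refine setIntegral_mono_on ?_ ?_ measurableSet_Ioi fun x hx => ?_
    · refine hint.integrableOn.congr_fun (fun x hx => ?_) measurableSet_Ioi
      dsimp only
      rw [abs_of_pos hx]
    · exact integrableOn_rpow_mul_exp_neg_mul_rpow (by linarith) (by norm_num) hb
    · have hx : 0 < x := hx
      rw [Real.rpow_two]
      exact mul_le_mul_of_nonneg_right
        (Real.rpow_le_rpow_of_nonpos hx (by linarith) (by linarith)) (Real.exp_pos _).le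
  rw [integral_prod_gaussian_eq σ hr]
  have h4 : r * (Real.pi * r ^ 2) ^ (-(-s + 1) / 2) = Real.pi ^ (-(-s + 1) / 2) * r ^ s := by
    have h5 : r ^ s = r ^ (1 : ℝ) * r ^ ((2 : ℕ) * (-(-s + 1) / 2)) := by
      rw [← Real.rpow_add hr]
      congr 1
      push_cast
      ring
    rw [Real.mul_rpow Real.pi_pos.le (by positivity), ← Real.rpow_natCast_mul hr.le, h5,
      Real.rpow_one]
    ring
  calc _ ≤ r * (C ^ 2 *
        (2 * ((Real.pi * r ^ 2) ^ (-(-s + 1) / 2) * (1 / 2) * Real.Gamma ((-s + 1) / 2)))) := by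
        gcongr
        exact h1.trans (mul_le_mul_of_nonneg_left h2 (sq_nonneg C))
    _ = C ^ 2 * (2 * ((r * (Real.pi * r ^ 2) ^ (-(-s + 1) / 2)) * (1 / 2) *
        Real.Gamma ((-s + 1) / 2))) := by ring
    _ = _ := by
        rw [h4]
        ring

/-- Efficient coverings bound the order of Fourier decay of the measures on a set. -/
lemma not_hasFourierDecay_of_cover {R : Set ℝ} {N : ℕ → ℕ} {a : ∀ n, Fin (N n) → ℝ} {w : ℕ → ℝ}
    (hw : ∀ n, 0 < w n) (hR : ∀ n, R ⊆ ⋃ m, Icc (a n m) (a n m + w n)) {s : ℝ} (hs0 : 0 ≤ s)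
    (hs1 : s < 1) (h : Tendsto (fun n => N n * w n ^ s) atTop (𝓝 0)) {σ : Measure ℝ}
    [IsFiniteMeasure σ] (hσ0 : σ ≠ 0) (hσR : ∀ᵐ x ∂σ, x ∈ R) : ¬ HasFourierDecay σ s := by
  intro hdecay
  obtain ⟨D, hD⟩ := exists_integral_prod_gaussian_le hs0 hs1 hdecay
  have key : ∀ n, Real.exp (-Real.pi) * σ.real univ ^ 2 ≤ D * (N n * w n ^ s) := by
    intro n
    set J : Fin (N n) → Set ℝ := disjointed fun m => Icc (a n m) (a n m + w n)
    have hJm : ∀ m, MeasurableSet (J m) := fun m => by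
      simp only [J, disjointed_apply, Finset.sup_set_eq_biUnion]
      exact measurableSet_Icc.diff (Finset.measurableSet_biUnion _ fun _ _ => measurableSet_Icc)
    have hJd : Pairwise (Function.onFun Disjoint J) := disjoint_disjointed _
    have hJR : σ.real univ = ∑ m, σ.real (J m) := by
      rw [← measureReal_iUnion_fintype hJd hJm, iUnion_disjointed]
      refine measureReal_congr ?_
      filter_upwards [hσR] with x hx
      exact propext ⟨fun _ => hR n hx, fun _ => trivial⟩
    have hcs : σ.real univ ^ 2 ≤ N n * ∑ m, σ.real (J m) ^ 2 := by
      rw [hJR]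
      simpa using sq_sum_le_card_mul_sum_sq (s := (Finset.univ : Finset (Fin (N n))))
        (f := fun m => σ.real (J m))
    set f : ℝ × ℝ → ℝ := fun p => Real.exp (-Real.pi * ((p.1 - p.2) / w n) ^ 2)
    have hf : Integrable f (σ.prod σ) := by
      refine Integrable.of_bound (C := 1) (Continuous.aestronglyMeasurable (by fun_prop))
        (Eventually.of_forall fun p => ?_)
      rw [Real.norm_of_nonneg (Real.exp_pos _).le, Real.exp_le_one_iff]
      have := Real.pi_pos
      have : 0 ≤ Real.pi * ((p.1 - p.2) / w n) ^ 2 := by positivity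
      linarith
    have hmark := mul_meas_ge_le_integral_of_nonneg (Eventually.of_forall fun p =>
      (Real.exp_pos _).le : 0 ≤ᵐ[σ.prod σ] f) hf (Real.exp (-Real.pi))
    have hsub : (⋃ m, J m ×ˢ J m) ⊆ {p | Real.exp (-Real.pi) ≤ f p} := by
      intro p hp
      obtain ⟨m, hm1, hm2⟩ := mem_iUnion.1 hp
      have h1 := disjointed_subset (fun m => Icc (a n m) (a n m + w n)) m hm1
      have h2 := disjointed_subset (fun m => Icc (a n m) (a n m + w n)) m hm2
      have h3 : ((p.1 - p.2) / w n) ^ 2 ≤ 1 := by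
        rw [sq_le_one_iff_abs_le_one, abs_div, abs_of_pos (hw n), div_le_one (hw n), abs_le]
        constructor <;> linarith [h1.1, h1.2, h2.1, h2.2]
      refine Real.exp_le_exp.2 ?_
      have := Real.pi_pos
      nlinarith
    have hprod : ∑ m, σ.real (J m) ^ 2 ≤ (σ.prod σ).real {p | Real.exp (-Real.pi) ≤ f p} := by
      have hd : Pairwise (Function.onFun Disjoint fun m => J m ×ˢ J m) := fun i j hij =>
        Set.disjoint_prod.2 (Or.inl (hJd hij))
      refine le_trans (le_of_eq ?_) (measureReal_mono hsub)
      rw [measureReal_iUnion_fintype hd fun m => (hJm m).prod (hJm m)]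
      refine Finset.sum_congr rfl fun m _ => ?_
      rw [measureReal_prod_prod, sq]
    have hE := hD (w n) (hw n)
    have hN : (0 : ℝ) ≤ N n := Nat.cast_nonneg _
    have he := Real.exp_pos (-Real.pi)
    calc Real.exp (-Real.pi) * σ.real univ ^ 2
        ≤ Real.exp (-Real.pi) * (N n * (σ.prod σ).real {p | Real.exp (-Real.pi) ≤ f p}) := by
          refine mul_le_mul_of_nonneg_left (hcs.trans ?_) he.le
          exact mul_le_mul_of_nonneg_left hprod hN
      _ = N n * (Real.exp (-Real.pi) * (σ.prod σ).real {p | Real.exp (-Real.pi) ≤ f p}) := by ring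
      _ ≤ N n * (D * w n ^ s) := mul_le_mul_of_nonneg_left (hmark.trans hE) hN
      _ = _ := by ring
  have hlim : Tendsto (fun n => D * (N n * w n ^ s)) atTop (𝓝 0) := by
    simpa using h.const_mul D
  have hle := ge_of_tendsto' hlim key
  have hpos : 0 < σ.real univ := by
    rw [measureReal_def]
    exact ENNReal.toReal_pos (by simpa using hσ0) (measure_ne_top _ _)
  have := Real.exp_pos (-Real.pi)
  have : 0 < Real.exp (-Real.pi) * σ.real univ ^ 2 := by positivity
  linarith

/-! ### Lower bounds for dimensions from the masses of intervals -/

/-- Mass distribution principle. -/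
lemma le_dimH_of_measure_Icc_le {μ : Measure ℝ} {R : Set ℝ} (hμR : μ R ≠ 0) {C : ℝ} (hC : 0 < C)
    {d : ℝ≥0} {ρ : ℝ} (hρ : 0 < ρ)
    (h : ∀ a r, 0 < r → r ≤ ρ → μ (Icc a (a + r)) ≤ ENNReal.ofReal (C * r ^ (d : ℝ))) :
    (d : ℝ≥0∞) ≤ dimH R := by
  refine le_dimH_of_hausdorffMeasure_ne_zero fun h0 => hμR ?_
  have hC0 : ENNReal.ofReal C ≠ 0 := by simpa using hC
  have hle : (ENNReal.ofReal C)⁻¹ • μ ≤ Measure.hausdorffMeasure (d : ℝ) := by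
    refine Measure.le_hausdorffMeasure _ _ (ENNReal.ofReal (ρ / 2)) (by simpa using hρ)
      fun s hs => ?_
    rcases s.eq_empty_or_nonempty with rfl | hne
    · simp
    have htop : Metric.ediam s ≠ ⊤ := ne_top_of_le_ne_top ENNReal.ofReal_ne_top hs
    have hbdd : Bornology.IsBounded s := Metric.isBounded_iff_ediam_ne_top.2 htop
    set δ := Metric.diam s
    have hδ : Metric.ediam s = ENNReal.ofReal δ := (ENNReal.ofReal_toReal htop).symm
    have hδ0 : 0 ≤ δ := Metric.diam_nonneg
    have hδρ : δ ≤ ρ / 2 := by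
      rw [hδ, ENNReal.ofReal_le_ofReal_iff (by positivity)] at hs
      exact hs
    have hsub : s ⊆ Icc (sInf s) (sInf s + δ) := fun x hx => by
      refine ⟨csInf_le hbdd.bddBelow hx, ?_⟩
      rw [← sub_le_iff_le_add']
      have h1 : x - δ ≤ sInf s := le_csInf hne fun y hy => by
        have := Metric.dist_le_diam_of_mem hbdd hx hy
        rw [Real.dist_eq] at this
        linarith [le_abs_self (x - y)]
      linarith
    -- Intervals of positive length are needed, and the length then decreases to `δ`.
    have hev : ∀ᶠ r in 𝓝[>] δ, μ s ≤ ENNReal.ofReal (C * r ^ (d : ℝ)) := by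
      filter_upwards [Ioc_mem_nhdsGT (show δ < ρ by linarith)] with r hr
      exact (measure_mono (hsub.trans (Icc_subset_Icc_right (by linarith [hr.1])))).trans
        (h _ r (hδ0.trans_lt hr.1) hr.2)
    have hlim : Tendsto (fun r => ENNReal.ofReal (C * r ^ (d : ℝ))) (𝓝[>] δ)
        (𝓝 (ENNReal.ofReal (C * δ ^ (d : ℝ)))) := by
      refine ENNReal.tendsto_ofReal (Tendsto.const_mul _ ?_)
      exact ((Real.continuousAt_rpow_const δ d (Or.inr d.2)).tendsto).mono_left
        nhdsWithin_le_nhds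
    have hfin := ge_of_tendsto hlim hev
    rw [Measure.smul_apply, smul_eq_mul, hδ, ENNReal.ofReal_rpow_of_nonneg hδ0 d.coe_nonneg,
      ENNReal.inv_mul_le_iff hC0 ENNReal.ofReal_ne_top, ← ENNReal.ofReal_mul hC.le]
    exact hfin
  have h1 := hle R
  rw [h0, Measure.smul_apply, smul_eq_mul] at h1
  rcases mul_eq_zero.1 (le_antisymm h1 zero_le) with h2 | h2
  · simp at h2
  · exact h2

/-- At points of the support the logarithm of the mass is not a junk value. -/
lemma le_lowerLocalDim {μ : Measure ℝ} [IsFiniteMeasure μ] {C d ρ : ℝ} (hC : 0 < C) (hρ : 0 < ρ)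
    (h : ∀ a r, 0 < r → r ≤ ρ → μ (Icc a (a + r)) ≤ ENNReal.ofReal (C * r ^ d)) {s : ℝ}
    (hs : s < d) {x : ℝ} (hx : x ∈ μ.support) : (s : EReal) ≤ lowerLocalDim μ x := by
  refine le_liminf_of_le (by isBoundedDefault) ?_
  have hlog : ∀ᶠ r in 𝓝[>] (0 : ℝ), Real.log (C * 2 ^ d) ≤ (s - d) * Real.log r := by
    have h1 : Tendsto (fun r => (s - d) * Real.log r) (𝓝[>] 0) atTop :=
      Real.tendsto_log_nhdsGT_zero.const_mul_atBot_of_neg (by linarith)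
    exact h1.eventually_ge_atTop _
  filter_upwards [hlog, Ioo_mem_nhdsGT (show (0 : ℝ) < min 1 (ρ / 2) by positivity)] with r hr1 hr2
  have hr0 : 0 < r := hr2.1
  have hr3 : r < 1 := hr2.2.trans_le (min_le_left _ _)
  have hr4 : r < ρ / 2 := hr2.2.trans_le (min_le_right _ _)
  have hpos : 0 < μ.real (Metric.ball x r) := by
    rw [measureReal_def]
    exact ENNReal.toReal_pos
      ((Measure.mem_support_iff_forall x).1 hx _ (Metric.ball_mem_nhds x hr0)).ne'
      (measure_ne_top _ _)
  have hle : μ.real (Metric.ball x r) ≤ C * 2 ^ d * r ^ d := by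
    have h1 : μ (Metric.ball x r) ≤ ENNReal.ofReal (C * (2 * r) ^ d) := by
      refine (measure_mono ?_).trans (h (x - r) (2 * r) (by linarith) (by linarith))
      rw [Real.ball_eq_Ioo]
      refine Ioo_subset_Icc_self.trans (Icc_subset_Icc_right (by linarith))
    rw [Real.mul_rpow (by norm_num) hr0.le, ← mul_assoc] at h1
    exact ENNReal.toReal_le_of_le_ofReal (by positivity) h1
  refine EReal.coe_le_coe_iff.2 ?_
  rw [le_div_iff_of_neg (Real.log_neg hr0 hr3)]
  have h2 := Real.log_le_log hpos hle
  rw [Real.log_mul (by positivity) (by positivity), Real.log_rpow hr0] at h2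
  linarith

lemma tendsto_scale : Tendsto scale atTop (𝓝 0) :=
  (tendsto_pow_atTop_nhds_zero_of_lt_one (by norm_num) (by norm_num : (1 / 2 : ℝ) < 1)).comp
    (tendsto_atTop_mono (fun n => by dsimp only [id]; nlinarith) tendsto_id)

section Tree

variable {T : ℕ → ℕ} {t : ℕ → ℕ → ℝ} {α : ℝ}

/-- The limit measure of an interval of length `r` is at most of order `r ^ d` for each `d < α`. -/
lemma exists_limitMeasure_Icc_le (hT : ∀ n, 0 < T n) (hT' : ∀ n, T n ≤ 2 ^ (2 * n + 3))
    (hTα : ∀ n, ((2 : ℝ) ^ (2 * n + 3)) ^ α ≤ T n) (ht : ∀ n m, t n m ∈ Icc (0 : ℝ) 1) {d : ℝ}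
    (hd0 : 0 ≤ d) (hd : d < α) (hα1 : α ≤ 1) :
    ∃ C, 0 < C ∧ ∀ a r, 0 < r → r ≤ 1 / 2 →
      limitMeasure T t (Icc a (a + r)) ≤ ENNReal.ofReal (C * r ^ d) := by
  set γ := α - d
  have hγ : 0 < γ := sub_pos.2 hd
  refine ⟨2 ^ (25 / γ), by positivity, fun a r hr0 hr => ?_⟩
  obtain ⟨n, hn1, hn2⟩ : ∃ n, scale (n + 1) < r ∧ r ≤ scale n := by
    have hex : ∃ n, scale n < r := (tendsto_scale.eventually_lt_const hr0).exists
    have h1 := Nat.find_spec hex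
    have h2 : Nat.find hex ≠ 0 := fun h => by
      rw [h, scale_zero] at h1
      linarith
    obtain ⟨n, hn⟩ := Nat.exists_eq_succ_of_ne_zero h2
    rw [hn] at h1
    refine ⟨n, h1, not_lt.1 (Nat.find_min hex (by omega))⟩
  refine (measure_mono (Icc_subset_Icc_right (by linarith))).trans
    ((limitMeasure_Icc_le hT hT' ht n a).trans (ENNReal.ofReal_le_ofReal ?_))
  have hn0 : (0 : ℝ) ≤ n := Nat.cast_nonneg n
  have h5 : (5 : ℝ) ^ n ≤ 2 ^ (3 * (n : ℝ)) := by
    rw [Real.rpow_mul (by norm_num), Real.rpow_natCast]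
    gcongr
    norm_num
  calc (5 : ℝ) ^ n / nodes T n ≤ 2 ^ (3 * (n : ℝ)) / 2 ^ (α * (((n : ℝ) + 1) ^ 2 - 1)) := by
        have := rpow_le_nodes hTα n
        gcongr
    _ = 2 ^ (3 * (n : ℝ) - α * (((n : ℝ) + 1) ^ 2 - 1)) := by rw [Real.rpow_sub (by norm_num)]
    _ ≤ 2 ^ (25 / γ + -(d * ((n : ℝ) + 2) ^ 2)) := by
        refine Real.rpow_le_rpow_of_exponent_le (by norm_num) ?_
        have h6 : 5 * ((n : ℝ) + 1) - γ * ((n : ℝ) + 1) ^ 2 ≤ 25 / γ := by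
          rw [le_div_iff₀ hγ]
          nlinarith [sq_nonneg (γ * ((n : ℝ) + 1) - 5), sq_nonneg (γ * ((n : ℝ) + 1))]
        have h7 : d ≤ 1 := by linarith
        have h8 : α = γ + d := by simp [γ]
        rw [h8]
        rw [h8] at hα1
        nlinarith
    _ = 2 ^ (25 / γ) * scale (n + 1) ^ d := by
        rw [Real.rpow_add (by norm_num), scale_eq_rpow, ← Real.rpow_mul (by norm_num)]
        congr 2
        push_cast
        ring
    _ ≤ 2 ^ (25 / γ) * r ^ d := by
        have := scale_pos (n + 1)
        gcongr

lemma tendsto_nodes_mul_rpow (hTα : ∀ n, (T n : ℝ) ≤ 4 * ((2 : ℝ) ^ (2 * n + 3)) ^ α) {d : ℝ}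
    (hd : α < d) : Tendsto (fun n => nodes T n * (2 * scale n) ^ d) atTop (𝓝 0) := by
  have hlim : Tendsto (fun n : ℕ => (2 : ℝ) ^ (d - α) * (1 / 2) ^ n) atTop (𝓝 0) := by
    simpa using (tendsto_pow_atTop_nhds_zero_of_lt_one (by norm_num)
      (by norm_num : (1 / 2 : ℝ) < 1)).const_mul ((2 : ℝ) ^ (d - α))
  refine squeeze_zero' (Eventually.of_forall fun n => ?_) ?_ hlim
  · have := scale_pos n
    positivity
  filter_upwards [eventually_ge_atTop ⌈3 / (d - α)⌉₊] with n hn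
  have h1 : 3 / (d - α) ≤ n := (Nat.le_ceil _).trans (by exact_mod_cast hn)
  rw [div_le_iff₀ (by linarith)] at h1
  have hn0 : (0 : ℝ) ≤ n := Nat.cast_nonneg n
  have h2 : (4 : ℝ) ^ n = 2 ^ (2 * (n : ℝ)) := by
    rw [Real.rpow_mul (by norm_num), Real.rpow_natCast]
    norm_num
  have h3 : (2 * scale n) ^ d = 2 ^ (d * (1 - ((n : ℝ) + 1) ^ 2)) := by
    have h5 : (2 : ℝ) * 2 ^ (-((n : ℝ) + 1) ^ 2) = 2 ^ (1 - ((n : ℝ) + 1) ^ 2) := by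
      rw [Real.rpow_sub (by norm_num), Real.rpow_neg (by norm_num), Real.rpow_one, div_eq_mul_inv]
    rw [scale_eq_rpow, h5, ← Real.rpow_mul (by norm_num), mul_comm d]
  have h4 : ((1 : ℝ) / 2) ^ n = 2 ^ (-(n : ℝ)) := by
    rw [Real.rpow_neg (by norm_num), Real.rpow_natCast, one_div, inv_pow]
  rw [h3, h4, ← Real.rpow_add (by norm_num)]
  refine (mul_le_mul_of_nonneg_right (nodes_le_rpow hTα n) (by positivity)).trans ?_
  rw [h2, ← Real.rpow_add (by norm_num), ← Real.rpow_add (by norm_num)]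
  refine Real.rpow_le_rpow_of_exponent_le (by norm_num) ?_
  nlinarith

end Tree

/-! ### Localization away from the origin -/

open scoped FourierTransform in
/-- A smooth compactly supported function is a superposition of characters, with a coefficient
function which decays fast. -/
lemma exists_integral_fexp_eq {f : ℝ → ℂ} (hf : HasCompactSupport f) (hf' : ContDiff ℝ ((⊤ : ℕ∞) : WithTop ℕ∞) f) :
    ∃ g : ℝ → ℂ, Integrable g ∧ Integrable (fun η => |η| * ‖g η‖) ∧
      ∀ y, f y = ∫ η, fexp (-(y * η)) * g η := by
  let F := hf.toSchwartzMap hf'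
  let G : SchwartzMap ℝ ℂ := 𝓕 F
  refine ⟨G, G.integrable, ?_, fun y => ?_⟩
  · simpa using G.integrable_pow_mul volume 1
  · have h1 : F y = 𝓕⁻ (𝓕 F) y := by rw [FourierTransform.fourierInv_fourier_eq]
    have h2 : f y = F y := rfl
    rw [h2, h1, SchwartzMap.fourierInv_coe, Real.fourierInv_eq']
    congr 1
    ext η
    rw [smul_eq_mul, fexp]
    congr 2
    simp

lemma measureHat_withDensity {ν : Measure ℝ} [IsFiniteMeasure ν] {b : ℝ → ℝ} (hb : Measurable b)
    (hb0 : ∀ y, 0 ≤ b y) {g : ℝ → ℂ} (hgi : Integrable g)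
    (h : ∀ y, (b y : ℂ) = ∫ η, fexp (-(y * η)) * g η) (ξ : ℝ) :
    measureHat (ν.withDensity fun y => ENNReal.ofReal (b y)) ξ =
      ∫ η, measureHat ν (ξ - η) * g η := by
  have hint : Integrable (Function.uncurry fun y η : ℝ => fexp (y * (ξ - η)) * g η)
      (ν.prod volume) := by
    refine (hgi.comp_snd ν).bdd_mul (c := 1) (f := fun q : ℝ × ℝ => fexp (q.1 * (ξ - q.2))) ?_ ?_
    · exact Continuous.aestronglyMeasurable (by fun_prop)
    · exact Eventually.of_forall fun q => (norm_fexp _).le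
  rw [measureHat_eq_integral_fexp, integral_withDensity_eq_integral_toReal_smul (by fun_prop)
    (Eventually.of_forall fun _ => ENNReal.ofReal_lt_top)]
  calc ∫ y, (ENNReal.ofReal (b y)).toReal • fexp (y * ξ) ∂ν
      = ∫ y, (∫ η, fexp (y * (ξ - η)) * g η) ∂ν := by
        congr 1
        ext y
        rw [ENNReal.toReal_ofReal (hb0 y), Complex.real_smul, h y, ← integral_mul_const]
        congr 1
        ext η
        rw [mul_right_comm, ← fexp_add]
        congr 2
        ring
    _ = ∫ η, (∫ y, fexp (y * (ξ - η)) * g η ∂ν) := integral_integral_swap hint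
    _ = _ := by
        congr 1
        ext η
        rw [integral_mul_const, measureHat_eq_integral_fexp]

/-- Multiplication by a smooth compactly supported density preserves Fourier decay. -/
lemma HasFourierDecay.withDensity {ν : Measure ℝ} [IsFiniteMeasure ν] {s : ℝ} (hs0 : 0 ≤ s)
    (hs2 : s ≤ 2) (hν : HasFourierDecay ν s) {b : ℝ → ℝ} (hb : HasCompactSupport b)
    (hb' : ContDiff ℝ ((⊤ : ℕ∞) : WithTop ℕ∞) b) (hb0 : ∀ y, 0 ≤ b y)
    [IsFiniteMeasure (ν.withDensity fun y => ENNReal.ofReal (b y))] :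
    HasFourierDecay (ν.withDensity fun y => ENNReal.ofReal (b y)) s := by
  obtain ⟨g, hgi, hgi', hg⟩ := exists_integral_fexp_eq (f := fun y => (b y : ℂ))
    (hb.comp_left Complex.ofReal_zero) (Complex.ofRealCLM.contDiff.comp hb')
  obtain ⟨C, hC0, hC⟩ := (hasFourierDecay_iff_exists ν hs0).1 hν
  refine (hasFourierDecay_iff_exists _ hs0).2 ⟨C * ∫ η, (‖g η‖ + |η| * ‖g η‖),
    mul_nonneg hC0 (integral_nonneg fun η => by positivity), fun ξ => ?_⟩
  rw [measureHat_withDensity hb'.continuous.measurable hb0 hgi hg, mul_right_comm,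
    ← integral_const_mul]
  refine norm_integral_le_of_norm_le ((hgi.norm.add hgi').const_mul _)
    (Eventually.of_forall fun η => ?_)
  -- The inequality `1 + |ξ| ≤ (1 + |ξ - η|) (1 + |η|)` moves the weight from `ξ - η` to `ξ`.
  have h1 : (1 + |ξ - η|) ^ (-(s / 2)) ≤ (1 + |ξ|) ^ (-(s / 2)) * (1 + |η|) := by
    have h2 : 1 + |ξ| ≤ (1 + |ξ - η|) * (1 + |η|) := by
      have := abs_add_le (ξ - η) η
      rw [sub_add_cancel] at this
      nlinarith [abs_nonneg (ξ - η), abs_nonneg η]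
    have h3 : (1 + |ξ|) ^ (s / 2) ≤ (1 + |ξ - η|) ^ (s / 2) * (1 + |η|) := by
      refine (Real.rpow_le_rpow (by positivity) h2 (by linarith)).trans ?_
      rw [Real.mul_rpow (by positivity) (by positivity)]
      gcongr
      exact (Real.rpow_le_rpow_of_exponent_le (by linarith [abs_nonneg η])
        (by linarith : s / 2 ≤ 1)).trans_eq (Real.rpow_one _)
    rw [Real.rpow_neg (by positivity), Real.rpow_neg (by positivity), inv_eq_one_div,
      inv_mul_eq_div, div_le_div_iff₀ (by positivity) (by positivity), one_mul, mul_comm]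
    linarith
  rw [norm_mul]
  calc _ ≤ C * ((1 + |ξ|) ^ (-(s / 2)) * (1 + |η|)) * ‖g η‖ := by
        gcongr
        exact (hC _).trans (by gcongr)
    _ = _ := by
        ring

lemma exists_ne_zero_mem_support {ν : Measure ℝ} [IsFiniteMeasure ν] (hν0 : ν ≠ 0) {s : ℝ}
    (hs : 0 < s) (hν : HasFourierDecay ν s) : ∃ y ∈ ν.support, y ≠ 0 := by
  by_contra! h
  have hae : ∀ᵐ y ∂ν, y = 0 := by
    filter_upwards [Measure.support_mem_ae (μ := ν)] with y hy using h y hy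
  have hconst : ∀ ξ, ‖measureHat ν ξ‖ = ν.real univ := fun ξ => by
    have h1 : measureHat ν ξ = ∫ _, (1 : ℂ) ∂ν := by
      rw [measureHat_eq_integral_fexp]
      refine integral_congr_ae ?_
      filter_upwards [hae] with y hy
      rw [hy, zero_mul, fexp_zero]
    rw [h1]
    simp
  obtain ⟨B, hB⟩ := hν
  have hpos : 0 < ν.real univ := by
    rw [measureReal_def]
    exact ENNReal.toReal_pos (by simpa using hν0) (measure_ne_top _ _)
  have hlim : Tendsto (fun ξ : ℝ => ν.real univ ^ 2 * ξ ^ s) atTop atTop :=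
    (tendsto_rpow_atTop hs).const_mul_atTop (by positivity)
  obtain ⟨ξ, hξ1, hξ0⟩ := ((hlim.eventually_gt_atTop B).and (eventually_ge_atTop 0)).exists
  have h2 := hB ⟨ξ, rfl⟩
  dsimp only at h2
  rw [hconst, abs_of_nonneg hξ0] at h2
  linarith

lemma exists_zero_notMem_support {ν : Measure ℝ} [IsFiniteMeasure ν] (hν0 : ν ≠ 0) {s : ℝ}
    (hs : 0 < s) (hs2 : s ≤ 2) (hν : HasFourierDecay ν s) :
    ∃ ν' : Measure ℝ, IsFiniteMeasure ν' ∧ ν' ≠ 0 ∧ ν'.support ⊆ ν.support ∧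
      (0 : ℝ) ∉ ν'.support ∧ HasFourierDecay ν' s := by
  obtain ⟨y₀, hy₀, hne⟩ := exists_ne_zero_mem_support hν0 hs hν
  have habs : 0 < |y₀| := abs_pos.2 hne
  let b : ContDiffBump y₀ := ⟨|y₀| / 4, |y₀| / 2, by positivity, by linarith⟩
  set ν' := ν.withDensity fun y => ENNReal.ofReal (b y)
  have hfin : IsFiniteMeasure ν' := by
    refine isFiniteMeasure_withDensity_ofReal ?_
    refine (Integrable.of_bound b.continuous.aestronglyMeasurable 1
      (Eventually.of_forall fun y => ?_)).2
    rw [Real.norm_of_nonneg b.nonneg]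
    exact b.le_one
  refine ⟨ν', hfin, fun h0 => ?_, (withDensity_absolutelyContinuous _ _).support_mono, ?_,
    hν.withDensity hs.le hs2 b.hasCompactSupport b.contDiff fun y => b.nonneg⟩
  · have h1 : ν' (Metric.ball y₀ (|y₀| / 4)) = ν (Metric.ball y₀ (|y₀| / 4)) := by
      rw [withDensity_apply _ Metric.isOpen_ball.measurableSet,
        setLIntegral_congr_fun (g := fun _ => 1) Metric.isOpen_ball.measurableSet]
      · simp
      · intro y hy
        dsimp only
        rw [b.one_of_mem_closedBall (Metric.ball_subset_closedBall hy), ENNReal.ofReal_one]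
    have h2 := (Measure.mem_support_iff_forall y₀).1 hy₀ _
      (Metric.ball_mem_nhds y₀ (by positivity : 0 < |y₀| / 4))
    rw [← h1, h0] at h2
    simp at h2
  · rw [Measure.notMem_support_iff_exists]
    refine ⟨Metric.ball 0 (|y₀| / 2), Metric.ball_mem_nhds _ (by positivity), ?_⟩
    rw [withDensity_apply _ Metric.isOpen_ball.measurableSet,
      setLIntegral_congr_fun (g := fun _ => 0) Metric.isOpen_ball.measurableSet]
    · simp
    · intro y hy
      dsimp only
      rw [b.zero_of_le_dist, ENNReal.ofReal_zero]
      rw [mem_ball_zero_iff, Real.norm_eq_abs] at hy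
      change |y₀| / 2 ≤ dist y y₀
      rw [Real.dist_eq, abs_sub_comm]
      linarith [abs_sub_abs_le_abs_sub y₀ y]

/-! ### The number of children -/

/-- The number of children of a node of generation `n`: about the power `α` of the ratio
`2 ^ (2 * n + 3)` of the lengths of consecutive generations, and at least four. -/
noncomputable def branching (α : ℝ) (n : ℕ) : ℕ := max 4 ⌈((2 : ℝ) ^ (2 * n + 3)) ^ α⌉₊

section Branching

variable {α : ℝ}

lemma four_le_branching (n : ℕ) : 4 ≤ branching α n := le_max_left _ _

lemma rpow_le_branching (n : ℕ) : ((2 : ℝ) ^ (2 * n + 3)) ^ α ≤ branching α n :=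
  (Nat.le_ceil _).trans (Nat.cast_le.2 (le_max_right _ _))

lemma branching_le (hα1 : α ≤ 1) (n : ℕ) : branching α n ≤ 2 ^ (2 * n + 3) := by
  have h1 : (1 : ℝ) ≤ 2 ^ (2 * n + 3) := one_le_pow₀ (by norm_num)
  refine max_le ?_ (Nat.ceil_le.2 ?_)
  · calc 4 = 2 ^ 2 := by norm_num
      _ ≤ _ := Nat.pow_le_pow_right (by norm_num) (by omega)
  · push_cast
    exact (Real.rpow_le_rpow_of_exponent_le h1 hα1).trans_eq (Real.rpow_one _)

lemma branching_le_four_mul (hα0 : 0 ≤ α) (n : ℕ) :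
    (branching α n : ℝ) ≤ 4 * ((2 : ℝ) ^ (2 * n + 3)) ^ α := by
  have h1 : (1 : ℝ) ≤ ((2 : ℝ) ^ (2 * n + 3)) ^ α :=
    Real.one_le_rpow (one_le_pow₀ (by norm_num)) hα0
  have h2 := Nat.ceil_lt_add_one (zero_le_one.trans h1)
  rw [branching, Nat.cast_max]
  refine max_le ?_ (by linarith)
  push_cast
  linarith

end Branching

/-! ### Measures with small support -/

lemma exists_abs_bounds {ν : Measure ℝ} (hc : IsCompact ν.support) (h0 : (0 : ℝ) ∉ ν.support) :
    ∃ A δ : ℝ, 0 ≤ A ∧ 0 < δ ∧ (∀ᵐ y ∂ν, |y| ≤ A) ∧ ∀ᵐ y ∂ν, δ ≤ |y| := by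
  obtain ⟨A, hA⟩ := hc.isBounded.exists_norm_le
  obtain ⟨δ, hδ0, hδ⟩ := Metric.isOpen_iff.1 hc.isClosed.isOpen_compl 0 h0
  refine ⟨max A 0, δ, le_max_right _ _, hδ0, ?_, ?_⟩
  · filter_upwards [Measure.support_mem_ae (μ := ν)] with y hy
    exact (hA y hy).trans (le_max_left _ _)
  · filter_upwards [Measure.support_mem_ae (μ := ν)] with y hy
    by_contra! h
    exact hδ (by simpa using h) hy

lemma mulMeasure_mem_measuresOn {μ ν : Measure ℝ} {R Y : Set ℝ} (hμ : μ ∈ measuresOn R)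
    (hν : ν ∈ measuresOn Y) : mulMeasure μ ν ∈ measuresOn (R * Y) := by
  obtain ⟨hμ1, hμ2, hμ3, hμ4⟩ := hμ
  obtain ⟨hν1, hν2, hν3, hν4⟩ := hν
  have hsub : (mulMeasure μ ν).support ⊆ μ.support * ν.support := by
    refine Measure.support_subset_of_isClosed (hμ3.mul hν3).isClosed ?_
    rw [mulMeasure, Measure.mconv]
    refine (ae_map_iff (by fun_prop) (hμ3.mul hν3).isClosed.measurableSet).2 ?_
    have h1 := Measure.quasiMeasurePreserving_fst (μ := μ) (ν := ν) |>.ae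
      (Measure.support_mem_ae (μ := μ))
    have h2 := Measure.quasiMeasurePreserving_snd (μ := μ) (ν := ν) |>.ae
      (Measure.support_mem_ae (μ := ν))
    filter_upwards [h1, h2] with p hp1 hp2
    exact Set.mul_mem_mul hp1 hp2
  refine ⟨inferInstance, fun h => ?_,
    (hμ3.mul hν3).of_isClosed_subset Measure.isClosed_support hsub,
    hsub.trans (Set.mul_subset_mul hμ4 hν4)⟩
  have h1 : mulMeasure μ ν univ = μ univ * ν univ := by
    rw [mulMeasure, Measure.mconv, Measure.map_apply (by fun_prop) MeasurableSet.univ,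
      preimage_univ, ← univ_prod_univ, Measure.prod_prod]
  rw [h] at h1
  rcases mul_eq_zero.1 h1.symm with h2 | h2
  · exact hμ2 (Measure.measure_univ_eq_zero.1 h2)
  · exact hν2 (Measure.measure_univ_eq_zero.1 h2)

lemma dirac_mem_measuresOn {Y : Set ℝ} {y : ℝ} (hy : y ∈ Y) :
    Measure.dirac y ∈ measuresOn Y ∧ (Measure.dirac y).support ⊆ {y} := by
  have hsub : (Measure.dirac y).support ⊆ {y} :=
    Measure.support_subset_of_isClosed isClosed_singleton (by simp)
  exact ⟨⟨inferInstance, IsProbabilityMeasure.ne_zero _,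
    isCompact_singleton.of_isClosed_subset Measure.isClosed_support hsub,
    hsub.trans (by simpa using hy)⟩, hsub⟩

lemma mulMeasure_dirac_one (μ : Measure ℝ) [IsFiniteMeasure μ] :
    mulMeasure μ (Measure.dirac 1) = μ := Measure.mconv_dirac_one μ

/-! ### The dimensions of the limit set -/

/-- For countably many measures with Fourier decay, there is one jittered Cantor set of dimension `α`
whose natural measure has products with all of these measures with the expected decay. -/
theorem exists_measure_of_seq {α : ℝ} (hα0 : 0 ≤ α) (hα1 : α ≤ 1) (ν : ℕ → Measure ℝ) (s : ℕ → ℝ)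
    (hfin : ∀ i, IsFiniteMeasure (ν i)) (hc : ∀ i, IsCompact (ν i).support)
    (h0 : ∀ i, (0 : ℝ) ∉ (ν i).support) (hs : ∀ i, 0 ≤ s i)
    (hν : ∀ i, HasFourierDecay (ν i) (s i)) :
    ∃ (μ : Measure ℝ) (R : Set ℝ), IsProbabilityMeasure μ ∧ R.Nonempty ∧ IsCompact R ∧
      R ⊆ Icc 1 2 ∧ μ ∈ measuresOn R ∧ dimH R = ENNReal.ofReal α ∧ dimF R = ENNReal.ofReal α ∧
      measureDimH μ = ENNReal.ofReal α ∧ measureDimF μ = ENNReal.ofReal α ∧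
      ∀ i (τ : ℝ), 0 ≤ τ → τ ≤ 1 → τ < α + s i → HasFourierDecay (mulMeasure μ (ν i)) τ := by
  -- The Dirac mass at `1` is added to the sequence to control the limit measure itself.
  obtain ⟨ν', hν'0, hν's⟩ : ∃ ν' : ℕ → Measure ℝ, ν' 0 = Measure.dirac 1 ∧ ∀ i, ν' (i + 1) = ν i :=
    ⟨fun i => Nat.rec (Measure.dirac 1) (fun i _ => ν i) i, rfl, fun _ => rfl⟩
  obtain ⟨s', hs'0, hs's⟩ : ∃ s' : ℕ → ℝ, s' 0 = 0 ∧ ∀ i, s' (i + 1) = s i :=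
    ⟨fun i => Nat.rec 0 (fun i _ => s i) i, rfl, fun _ => rfl⟩
  have hdirac := dirac_mem_measuresOn (mem_singleton (1 : ℝ))
  have hν' : ∀ i, IsFiniteMeasure (ν' i) ∧ IsCompact (ν' i).support ∧ (0 : ℝ) ∉ (ν' i).support ∧
      0 ≤ s' i ∧ HasFourierDecay (ν' i) (s' i) := fun i => by
    cases i with
    | zero =>
      rw [hν'0, hs'0]
      exact ⟨hdirac.1.1, hdirac.1.2.2.1, fun h => zero_ne_one (hdirac.2 h), le_rfl,
        hasFourierDecay_zero _⟩
    | succ i =>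
      rw [hν's, hs's]
      exact ⟨hfin i, hc i, h0 i, hs i, hν i⟩
  have hfin' : ∀ i, IsFiniteMeasure (ν' i) := fun i => (hν' i).1
  have hs' : ∀ i, 0 ≤ s' i := fun i => (hν' i).2.2.2.1
  have hbound : ∀ i, ∃ C, 0 ≤ C ∧ ∀ ξ, ‖measureHat (ν' i) ξ‖ ≤ C * (1 + |ξ|) ^ (-(s' i / 2)) :=
    fun i => (hasFourierDecay_iff_exists (ν' i) (hs' i)).1 (hν' i).2.2.2.2
  choose C hC0 hC using hbound
  set T := branching α
  have hT4 : ∀ n, 4 ≤ T n := four_le_branching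
  have hT : ∀ n, 0 < T n := fun n => by linarith [hT4 n]
  have hT' : ∀ n, T n ≤ 2 ^ (2 * n + 3) := branching_le hα1
  have hTα : ∀ n, ((2 : ℝ) ^ (2 * n + 3)) ^ α ≤ T n := rpow_le_branching
  have hTα' : ∀ n, (T n : ℝ) ≤ 4 * ((2 : ℝ) ^ (2 * n + 3)) ^ α := branching_le_four_mul hα0
  obtain ⟨t, ht, hctrl⟩ := exists_controlled_tree hT ν' (C := fun i => C i + 1) (s := s')
    (fun i => by linarith [hC0 i]) hs' fun i ξ => (hC i ξ).trans (by gcongr; linarith)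
  set μ := limitMeasure T t
  set R := limitSet T t
  have hdecay : ∀ i (τ : ℝ), 0 ≤ τ → τ ≤ 1 → τ < α + s' i →
      HasFourierDecay (mulMeasure μ (ν' i)) τ := by
    intro i τ hτ0 hτ1 hτ
    obtain ⟨A, δ, hA0, hδ0, hA, hδ⟩ := exists_abs_bounds (hν' i).2.1 (hν' i).2.2.1
    exact hasFourierDecay_mulMeasure hα0 hα1 hT4 hTα ht hA0 hA hδ0 hδ (by linarith [hC0 i]) (hs' i)
      (hctrl i) hτ0 (by linarith) hτ
  have hRc : IsCompact R := isCompact_limitSet hT ht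
  have hμR : μ ∈ measuresOn R := ⟨inferInstance, IsProbabilityMeasure.ne_zero μ,
    hRc.of_isClosed_subset Measure.isClosed_support support_limitMeasure_subset,
    support_limitMeasure_subset⟩
  have hμRae : ∀ᵐ x ∂μ, x ∈ R := mem_of_superset Measure.support_mem_ae hμR.2.2.2
  have hw : ∀ n, 0 < 2 * scale n := fun n => by linarith [scale_pos n]
  have hw0 : Tendsto (fun n => 2 * scale n) atTop (𝓝 0) := by
    simpa using tendsto_scale.const_mul 2
  have hcover := limitSet_subset_iUnion hT ht
  -- Fourier decay of order `r` of a measure on `R` requires `r ≤ α`.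
  have hupper : ∀ σ ∈ measuresOn R, ∀ r : ℝ≥0, r ≤ 1 → HasFourierDecay σ r →
      (r : ℝ≥0∞) ≤ ENNReal.ofReal α := by
    rintro σ ⟨hσ1, hσ2, -, hσ4⟩ r hr1 hr
    by_contra! hlt
    rw [ENNReal.ofReal_lt_iff_lt_toReal hα0 ENNReal.coe_ne_top, ENNReal.coe_toReal] at hlt
    have hr1' : (r : ℝ) ≤ 1 := by exact_mod_cast hr1
    exact not_hasFourierDecay_of_cover (s := (α + r) / 2) hw hcover (by linarith) (by linarith)
      (tendsto_nodes_mul_rpow hTα' (by linarith)) hσ2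
      (mem_of_superset Measure.support_mem_ae hσ4) (hr.mono (by linarith) (by linarith))
  have hlower : ∀ r : ℝ≥0, (r : ℝ≥0∞) < ENNReal.ofReal α → HasFourierDecay μ r := by
    intro r hr
    rw [ENNReal.lt_ofReal_iff_toReal_lt ENNReal.coe_ne_top, ENNReal.coe_toReal] at hr
    have := hdecay 0 r r.coe_nonneg (by linarith) (by rwa [hs'0, add_zero])
    rwa [hν'0, mulMeasure_dirac_one] at this
  have hle1 : ∀ r : ℝ≥0, (r : ℝ≥0∞) < ENNReal.ofReal α → r ≤ 1 := fun r hr => by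
    have h1 := hr.le.trans (ENNReal.ofReal_le_ofReal hα1)
    rw [ENNReal.ofReal_one] at h1
    exact_mod_cast h1
  refine ⟨μ, R, inferInstance, limitSet_nonempty, hRc, limitSet_subset_Icc hT ht, hμR,
    le_antisymm ?_ ?_, le_antisymm ?_ ?_, le_antisymm ?_ ?_, le_antisymm ?_ ?_,
    fun i => by simpa only [hν's, hs's] using hdecay (i + 1)⟩
  · refine le_of_forall_gt_imp_ge_of_dense fun c hc => ?_
    obtain ⟨d, hd1, hd2⟩ := ENNReal.lt_iff_exists_nnreal_btwn.1 hc
    rw [ENNReal.ofReal_lt_iff_lt_toReal hα0 ENNReal.coe_ne_top, ENNReal.coe_toReal] at hd1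
    exact (dimH_le_of_cover hw hw0 hcover (tendsto_nodes_mul_rpow hTα' hd1)).trans hd2.le
  · refine ENNReal.le_of_forall_nnreal_lt fun r hr => ?_
    rw [ENNReal.lt_ofReal_iff_toReal_lt ENNReal.coe_ne_top, ENNReal.coe_toReal] at hr
    obtain ⟨D, hD0, hD⟩ := exists_limitMeasure_Icc_le hT hT' hTα ht r.coe_nonneg hr hα1
    refine le_dimH_of_measure_Icc_le (μ := μ) (fun h => ?_) hD0 (by norm_num) hD
    have h1 : ∀ᵐ _ ∂μ, False := by
      filter_upwards [hμRae, measure_eq_zero_iff_ae_notMem.1 h] with x hx hx'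
      exact hx' hx
    exact hμR.2.1 (ae_eq_bot.1 (eventually_false_iff_eq_bot.1 h1))
  · exact iSup₂_le fun r ⟨hr1, σ, hσ, hr⟩ => hupper σ hσ r hr1 hr
  · refine ENNReal.le_of_forall_nnreal_lt fun r hr => ?_
    exact le_iSup₂_of_le r ⟨hle1 r hr, μ, hμR, hlower r hr⟩ le_rfl
  · refine iSup₂_le fun r hr => ?_
    by_contra! hlt
    rw [ENNReal.ofReal_lt_iff_lt_toReal hα0 ENNReal.coe_ne_top, ENNReal.coe_toReal] at hlt
    exact not_ae_le_lowerLocalDim_of_cover (d := (α + r) / 2) hw hw0 hcover (by linarith)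
      (tendsto_nodes_mul_rpow hTα' (by linarith)) hμR.2.1 hμRae hr
  · refine ENNReal.le_of_forall_nnreal_lt fun r hr => ?_
    obtain ⟨d, hrd, hd⟩ := ENNReal.lt_iff_exists_nnreal_btwn.1 hr
    rw [ENNReal.lt_ofReal_iff_toReal_lt ENNReal.coe_ne_top, ENNReal.coe_toReal] at hd
    obtain ⟨D, hD0, hD⟩ := exists_limitMeasure_Icc_le hT hT' hTα ht d.coe_nonneg hd hα1
    refine le_iSup₂_of_le r ?_ le_rfl
    filter_upwards [Measure.support_mem_ae (μ := μ)] with x hx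
    exact le_lowerLocalDim hD0 (by norm_num) hD (by exact_mod_cast hrd) hx
  · exact iSup₂_le fun r ⟨hr1, hr⟩ => hupper μ hμR r hr1 hr
  · refine ENNReal.le_of_forall_nnreal_lt fun r hr => ?_
    exact le_iSup₂_of_le r ⟨hle1 r hr, hlower r hr⟩ le_rfl

/-- One measure works for all the measures of a given class, since only the rational orders of decay
have to be taken into account. -/
theorem exists_measure_of_class {α : ℝ} (hα0 : 0 ≤ α) (hα1 : α ≤ 1) (P : Measure ℝ → Prop)
    (hP : ∀ ν, P ν → IsFiniteMeasure ν ∧ IsCompact ν.support ∧ (0 : ℝ) ∉ ν.support)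
    (hne : ∃ ν, P ν) :
    ∃ (μ : Measure ℝ) (R : Set ℝ), IsProbabilityMeasure μ ∧ R.Nonempty ∧ IsCompact R ∧
      R ⊆ Icc 1 2 ∧ μ ∈ measuresOn R ∧ dimH R = ENNReal.ofReal α ∧ dimF R = ENNReal.ofReal α ∧
      measureDimH μ = ENNReal.ofReal α ∧ measureDimF μ = ENNReal.ofReal α ∧
      ∀ r s : ℝ≥0, r ≤ 1 → (∃ ν, P ν ∧ HasFourierDecay ν s) → (r : ℝ) < α + s →
        ∃ ν, P ν ∧ HasFourierDecay (mulMeasure μ ν) r := by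
  obtain ⟨f, hf⟩ := exists_surjective_nat ℚ
  have hseq : ∀ i, ∃ (ν : Measure ℝ) (s : ℝ), P ν ∧ 0 ≤ s ∧ HasFourierDecay ν s ∧
      ((0 : ℝ) ≤ f i → (∃ ν, P ν ∧ HasFourierDecay ν (f i)) → s = f i) := by
    intro i
    by_cases h : (0 : ℝ) ≤ f i ∧ ∃ ν, P ν ∧ HasFourierDecay ν (f i)
    · obtain ⟨h1, ν, h2, h3⟩ := h
      exact ⟨ν, f i, h2, h1, h3, fun _ _ => rfl⟩
    · obtain ⟨ν, hν⟩ := hne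
      have := (hP ν hν).1
      exact ⟨ν, 0, hν, le_rfl, hasFourierDecay_zero ν, fun h1 h2 => absurd ⟨h1, h2⟩ h⟩
  choose ν s h1 h2 h3 h4 using hseq
  obtain ⟨μ, R, hμ, hR1, hR2, hR3, hμR, hd1, hd2, hd3, hd4, hdecay⟩ :=
    exists_measure_of_seq hα0 hα1 ν s (fun i => (hP _ (h1 i)).1) (fun i => (hP _ (h1 i)).2.1)
      (fun i => (hP _ (h1 i)).2.2) h2 h3
  refine ⟨μ, R, hμ, hR1, hR2, hR3, hμR, hd1, hd2, hd3, hd4, fun r σ hr ⟨ρ, hρP, hρ⟩ hrσ => ?_⟩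
  have hr' : (r : ℝ) ≤ 1 := by exact_mod_cast hr
  rcases lt_or_ge (r : ℝ) α with hlt | hge
  · exact ⟨ν 0, h1 0, hdecay 0 r r.coe_nonneg hr' (by linarith [h2 0])⟩
  · obtain ⟨q, hq1, hq2⟩ := exists_rat_btwn (show (r : ℝ) - α < σ by linarith)
    obtain ⟨i, rfl⟩ := hf q
    have hq0 : (0 : ℝ) ≤ f i := by linarith
    have := (hP ρ hρP).1
    have hsi := h4 i hq0 ⟨ρ, hρP, hρ.mono hq0 hq2.le⟩
    exact ⟨ν i, h1 i, hdecay i r r.coe_nonneg hr' (by rw [hsi]; linarith)⟩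

lemma min_one_add_iSup_le {a X : ℝ≥0∞} (ha : a ≠ ⊤) {p : ℝ≥0 → Prop} (h0 : p 0)
    (h : ∀ r s : ℝ≥0, r ≤ 1 → p s → (r : ℝ≥0∞) < a + s → (r : ℝ≥0∞) ≤ X) :
    min 1 (a + ⨆ (s : ℝ≥0) (_ : p s), (s : ℝ≥0∞)) ≤ X := by
  refine ENNReal.le_of_forall_nnreal_lt fun r hr => ?_
  obtain ⟨hr1, hr2⟩ := lt_min_iff.1 hr
  by_contra hX
  have hall : ∀ s, p s → a + s ≤ r := fun s hs => by
    by_contra! hlt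
    exact hX (h r s (by exact_mod_cast hr1.le) hs hlt)
  have har : a ≤ r := by simpa using hall 0 h0
  have hsup : ⨆ (s : ℝ≥0) (_ : p s), (s : ℝ≥0∞) ≤ r - a :=
    iSup₂_le fun s hs => ENNReal.le_sub_of_add_le_left ha (hall s hs)
  refine absurd hr2 (not_lt.2 ?_)
  calc _ ≤ a + (r - a) := by gcongr
    _ = r := add_tsub_cancel_of_le har

end FourierDimension

open FourierDimension in
theorem mainTheorem1 (α : ℝ) (hα : α ∈ Set.Icc (0 : ℝ) 1) :
    (∀ Y : Set ℝ, IsCompact Y → (∃ y ∈ Y, y ≠ 0) →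
      ∃ R : Set ℝ, R.Nonempty ∧ IsCompact R ∧ R ⊆ Set.Ioi 0 ∧
        dimH R = ENNReal.ofReal α ∧
        FourierDimension.dimF R = ENNReal.ofReal α ∧
        min 1 (FourierDimension.dimF R + FourierDimension.dimF Y) ≤
          FourierDimension.dimF (R * Y)) ∧
    (∀ ν : Measure ℝ, IsFiniteMeasure ν → ν ≠ 0 → IsCompact ν.support → (0 : ℝ) ∉ ν.support →
      ∃ μ : Measure ℝ, IsProbabilityMeasure μ ∧ μ.support ⊆ Set.Icc 1 2 ∧
        FourierDimension.measureDimH μ = ENNReal.ofReal α ∧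
        FourierDimension.measureDimF μ = ENNReal.ofReal α ∧
        min 1 (FourierDimension.measureDimF μ + FourierDimension.measureDimF ν) ≤
          FourierDimension.measureDimF (FourierDimension.mulMeasure μ ν)) := by
  have hlt : ∀ r s : ℝ≥0, (r : ℝ≥0∞) < ENNReal.ofReal α + s → (r : ℝ) < α + s := fun r s h => by
    rw [← ENNReal.ofReal_coe_nnreal (p := s), ← ENNReal.ofReal_add hα.1 s.coe_nonneg,
      ENNReal.lt_ofReal_iff_toReal_lt ENNReal.coe_ne_top] at h
    exact h
  refine ⟨fun Y _ ⟨y, hyY, hy0⟩ => ?_, fun ν hν hν0 hνc h0 => ?_⟩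
  · have hdirac := dirac_mem_measuresOn hyY
    have hdirac0 : (0 : ℝ) ∉ (Measure.dirac y).support := fun h => hy0 (hdirac.2 h).symm
    obtain ⟨μ, R, -, hR1, hR2, hR3, hμR, hd1, hd2, -, -, hdecay⟩ :=
      exists_measure_of_class hα.1 hα.2 (fun ν => ν ∈ measuresOn Y ∧ (0 : ℝ) ∉ ν.support)
        (fun ν h => ⟨h.1.1, h.1.2.2.1, h.2⟩) ⟨_, hdirac.1, hdirac0⟩
    refine ⟨R, hR1, hR2, fun x hx => zero_lt_one.trans_le (hR3 hx).1, hd1, hd2, ?_⟩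
    rw [hd2]
    refine min_one_add_iSup_le ENNReal.ofReal_ne_top
      ⟨zero_le_one, _, hdirac.1, hasFourierDecay_zero _⟩ fun r s hr ⟨hs1, σ, hσ, hs⟩ hrs => ?_
    -- A measure with decay of positive order is localized away from the origin first.
    have hgood : ∃ ν, (ν ∈ measuresOn Y ∧ (0 : ℝ) ∉ ν.support) ∧ HasFourierDecay ν s := by
      rcases eq_or_lt_of_le (zero_le : 0 ≤ s) with hs0 | hs0
      · rw [← hs0]
        exact ⟨_, ⟨hdirac.1, hdirac0⟩, hasFourierDecay_zero _⟩
      · obtain ⟨hσ1, hσ2, hσ3, hσ4⟩ := hσ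
        have hs1' : (s : ℝ) ≤ 1 := by exact_mod_cast hs1
        obtain ⟨σ', h1, h2, h3, h4, h5⟩ := exists_zero_notMem_support hσ2
          (by exact_mod_cast hs0) (by linarith) hs
        exact ⟨σ', ⟨⟨h1, h2, hσ3.of_isClosed_subset Measure.isClosed_support h3,
          h3.trans hσ4⟩, h4⟩, h5⟩
    obtain ⟨ρ, hρ1, hρ2⟩ := hdecay r s hr hgood (hlt r s hrs)
    exact le_iSup₂_of_le r ⟨hr, _, mulMeasure_mem_measuresOn hμR hρ1.1, hρ2⟩ le_rfl
  · obtain ⟨μ, R, hμ, -, -, hR3, hμR, -, -, hd3, hd4, hdecay⟩ :=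
      exists_measure_of_class hα.1 hα.2 (fun ν' => ν' = ν)
        (fun ν' h => h ▸ ⟨hν, hνc, h0⟩) ⟨ν, rfl⟩
    refine ⟨μ, hμ, hμR.2.2.2.trans hR3, hd3, hd4, ?_⟩
    rw [hd4]
    refine min_one_add_iSup_le ENNReal.ofReal_ne_top
      ⟨zero_le_one, hasFourierDecay_zero _⟩ fun r s hr ⟨hs1, hs⟩ hrs => ?_
    obtain ⟨_, rfl, hρ⟩ := hdecay r s hr ⟨ν, rfl, hs⟩ (hlt r s hrs)
    exact le_iSup₂_of_le r ⟨hr, hρ⟩ le_rfl
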